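/- **Setting.** In the stage game an agent draws $x_1\in\mathbb R$ and either stops, with payoff $u_1(x_1)$, or continues, draws $x_2\in\mathbb R$ and gets $u_2(x_1,x_2)$. The cutoff strategy with threshold $c\in\mathbb R$ stops iff $x_1>c$; its history is $(x_1,\varnothing)$ if $x_1>c$ and $(x_1,x_2)$ if $x_1\le c$. Objectively $X_1\sim\mathcal N(\mu_1^\bullet,\sigma^2)$ and $X_2\sim\mathcal N(\mu_2^\bullet,\sigma^2)$ are independent, $\sigma^2>0$. For a bias $\gamma>0$ and fundamentals $(\mu_1,\mu_2)$, the subjective model $\Psi(\mu_1,\mu_2;\gamma)$ is the joint law with $X_1\sim\mathcal N(\mu_1,\sigma^2)$ and $X_2\mid X_1=x_1\sim\mathcal N(\mu_2-\gamma(x_1-\mu_1),\sigma^2)$. **Assumption 1.** (a) $u_1$ is strictly increasing, and $u_2$ is strictly increasing in $x_2$. (b) For $x_1'>x_1''$ and any $x_2$, $u_1(x_1')-u_1(x_1'')>|u_2(x_1',x_2)-u_2(x_1'',x_2)|$. (c) $u_1-u_2$ is positive at some pair $(x_1,x_2)$ and negative at some other. (d) $u_1,u_2$ are continuous, and $u_2(x_1,\cdot)$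 is integrable against every Gaussian law, for every $x_1$. **Assumption 2.** There is $0<\ell<1/\gamma$ such that $u_1(x_1+\ell d)-u_1(x_1)\ge u_2(x_1+\ell d,\,x_2+(1-\gamma\ell)d)-u_2(x_1,x_2)$ for all $x_1,x_2\in\mathbb R$ and $d>0$. **Steady state.** Let $C(\mu_1,\mu_2;\gamma)$ be the cutoff below which continuing, and above which stopping, is strictly optimal under $\Psi(\mu_1,\mu_2;\gamma)$. A steady state is a triple $(\mu_1^\infty,\mu_2^\infty,c^\infty)\in\mathbb R^3$ such that $c^\infty=C(\mu_1^\infty,\mu_2^\infty;\gamma)$ and $(\mu_1^\infty,\mu_2^\infty)$ minimizes over $\mathbb R^2$ the Kullback–Leibler divergence from the true distribution of histories censored at $c^\infty$ to the one implied by $\Psi(\cdot,\cdot;\gamma)$ with the same censoring. The objectively optimal cutoff $c^\bullet\in[-\infty,\infty]$ is the threshold below which continuing, and above which stopping, is strictly optimal under the true law of $(X_1,X_2)$. **Learning.** Let $\lozenge\subset\mathbb R^2$ be a bounded nondegenerate parallelogram with vertical left and right edges and with top and bottom edges of slope $-\gamma$, and let $g$ be a continuous, strictly positive probability density on $\lozenge$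 whose partial derivatives exist in the interior and extend continuously to $\lozenge$. Agents act in rounds $t=1,2,\dots$, the potential draws being i.i.d. over rounds from the true law. Agent $t$ observes the histories of all earlier agents, updates $g$ by Bayes' rule (with the likelihoods given by the models $\Psi(\mu_1,\mu_2;\gamma)$) to a posterior density $\tilde g_t$ on $\lozenge$, and uses a cutoff $\tilde C_t$ that maximizes her expected payoff over all cutoffs under this posterior; $\tilde C_t$ is a measurable function of the draws of the earlier rounds. **Theorem 1.** Suppose Assumptions 1 and 2 hold. There is exactly one steady state; it has $\mu_1^\infty=\mu_1^\bullet$, and it depends neither on $\lozenge$ nor on $g$. Whenever $(\mu_1^\bullet,\mu_2^\infty)\in\lozenge$, almost surely $$\lim_{t\to\infty}\tilde C_t=c^\infty\quad\text{and}\quad\lim_{t\to\infty}\mathbb E_{(\mu_1,\mu_2)\sim\tilde g_t}\big[|\mu_1-\mu_1^\bullet|+|\mu_2-\mu_2^\infty|\big]=0 .$$ Moreover $\mu_2^\infty<\mu_2^\bullet$ and $c^\infty<c^\bullet$. -/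

import Mathlib

open MeasureTheory ProbabilityTheory Set Filter Topology
open scoped NNReal

noncomputable section

namespace GamblersFallacy

/-! The stage game.  Payoffs: `u₁ x₁` when stopping after the first draw `x₁`, and `u₂ x₁ x₂` when
continuing and then drawing `x₂`.  Throughout, `v` is the variance `σ²` of the draws, `γ` is the bias
parameter, and a pair of fundamentals `(μ₁, μ₂)` is a point `μ : ℝ × ℝ`. -/

/-- The regularity conditions (a)-(d) on the payoff functions. -/
structure RegularPayoffs (u₁ : ℝ → ℝ) (u₂ : ℝ → ℝ → ℝ) : Prop where
  strictMono_fst : StrictMono u₁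
  strictMono_snd : ∀ x₁, StrictMono (u₂ x₁)
  abs_sub_lt : ∀ x y z : ℝ, x < y → |u₂ y z - u₂ x z| < u₁ y - u₁ x
  exists_stop : ∃ x₁ x₂ : ℝ, 0 < u₁ x₁ - u₂ x₁ x₂
  exists_continue : ∃ x₁ x₂ : ℝ, u₁ x₁ - u₂ x₁ x₂ < 0
  continuous_fst : Continuous u₁
  continuous_snd : Continuous (fun x : ℝ × ℝ => u₂ x.1 x.2)
  integrable : ∀ (x₁ m : ℝ) (w : ℝ≥0), Integrable (u₂ x₁) (gaussianReal m w)

/-- The `ℓ`-Lipschitz condition, a joint restriction on the payoffs and the bias. -/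
def LipschitzPayoffs (u₁ : ℝ → ℝ) (u₂ : ℝ → ℝ → ℝ) (γ : ℝ) : Prop :=
  ∃ l : ℝ, 0 < l ∧ l < 1 / γ ∧ ∀ x₁ x₂ d : ℝ, 0 < d →
    u₂ (x₁ + l * d) (x₂ + (1 - γ * l) * d) - u₂ x₁ x₂ ≤ u₁ (x₁ + l * d) - u₁ x₁

/-- The subjective model `Ψ(μ₁, μ₂; γ)`: the joint law of `(X₁, X₂)` under which `X₁ ∼ N(μ₁, σ²)`
and, given `X₁ = x₁`, `X₂ ∼ N(μ₂ - γ (x₁ - μ₁), σ²)`. -/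
def subjectiveModel (γ : ℝ) (v : ℝ≥0) (μ : ℝ × ℝ) : Measure (ℝ × ℝ) :=
  volume.withDensity fun x =>
    gaussianPDF μ.1 v x.1 * gaussianPDF (μ.2 - γ * (x.1 - μ.1)) v x.2

/-- Expected payoff of continuing after `X₁ = x₁` under `Ψ(μ₁, μ₂; γ)`. -/
def continuationPayoff (u₂ : ℝ → ℝ → ℝ) (γ : ℝ) (v : ℝ≥0) (μ : ℝ × ℝ) (x₁ : ℝ) : ℝ :=
  ∫ x₂, u₂ x₁ x₂ ∂(gaussianReal (μ.2 - γ * (x₁ - μ.1)) v)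

/-- `c` is the optimal cutoff `C(μ₁, μ₂; γ)` under the model `Ψ(μ₁, μ₂; γ)`: it is strictly optimal
to continue below `c` and strictly optimal to stop above `c`.  Here `c = ⊥` means always stopping and
`c = ⊤` means never stopping.  There is at most one such `c`. -/
def IsModelCutoff (u₁ : ℝ → ℝ) (u₂ : ℝ → ℝ → ℝ) (γ : ℝ) (v : ℝ≥0) (μ : ℝ × ℝ) (c : EReal) : Prop :=
  (∀ x₁ : ℝ, (x₁ : EReal) < c → u₁ x₁ < continuationPayoff u₂ γ v μ x₁) ∧
  (∀ x₁ : ℝ, c < (x₁ : EReal) → continuationPayoff u₂ γ v μ x₁ < u₁ x₁)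

theorem IsModelCutoff.unique {u₁ : ℝ → ℝ} {u₂ : ℝ → ℝ → ℝ} {γ : ℝ} {v : ℝ≥0} {μ : ℝ × ℝ}
    {c c' : EReal} (h : IsModelCutoff u₁ u₂ γ v μ c) (h' : IsModelCutoff u₁ u₂ γ v μ c') :
    c = c' := by
  rcases lt_trichotomy c c' with hlt | heq | hlt
  · obtain ⟨x, hx, hx'⟩ := EReal.lt_iff_exists_real_btwn.1 hlt
    exact absurd (h.2 x hx) (not_lt.2 (h'.1 x hx').le)
  · exact heq
  · obtain ⟨x, hx, hx'⟩ := EReal.lt_iff_exists_real_btwn.1 hlt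
    exact absurd (h'.2 x hx) (not_lt.2 (h.1 x hx').le)

/-- The Kullback-Leibler divergence from the true law of histories (independent draws
`X₁ ∼ N(μ₁•, σ²)`, `X₂ ∼ N(μ₂•, σ²)`) to the law of histories under `Ψ(μ₁, μ₂; γ)`, where in both
the second draw is censored iff `X₁ > c`.  Here `μt = (μ₁•, μ₂•)`. -/
def historyKL (γ : ℝ) (v : ℝ≥0) (μt : ℝ × ℝ) (c : ℝ) (μ : ℝ × ℝ) : ℝ :=
  (∫ x₁ in Ioi c, gaussianPDFReal μt.1 v x₁ *
      Real.log (gaussianPDFReal μt.1 v x₁ / gaussianPDFReal μ.1 v x₁)) +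
  ∫ x₁ in Iic c, ∫ x₂, gaussianPDFReal μt.1 v x₁ * gaussianPDFReal μt.2 v x₂ *
      Real.log ((gaussianPDFReal μt.1 v x₁ * gaussianPDFReal μt.2 v x₂) /
        (gaussianPDFReal μ.1 v x₁ * gaussianPDFReal (μ.2 - γ * (x₁ - μ.1)) v x₂))

/-- `μ` is a pair of pseudo-true fundamentals with respect to the cutoff `c`. -/
def IsPseudoTrue (γ : ℝ) (v : ℝ≥0) (μt : ℝ × ℝ) (c : ℝ) (μ : ℝ × ℝ) : Prop :=
  ∀ μ' : ℝ × ℝ, historyKL γ v μt c μ ≤ historyKL γ v μt c μ'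

/-- A steady state: a pair of fundamentals `μ` and a cutoff `c` such that `c` is the optimal cutoff
under `Ψ(μ; γ)` and `μ` is pseudo-true with respect to `c`. -/
def IsSteadyState (u₁ : ℝ → ℝ) (u₂ : ℝ → ℝ → ℝ) (γ : ℝ) (v : ℝ≥0) (μt : ℝ × ℝ)
    (μ : ℝ × ℝ) (c : ℝ) : Prop :=
  IsModelCutoff u₁ u₂ γ v μ (c : EReal) ∧ IsPseudoTrue γ v μt c μ

/-! Social learning with agents acting one at a time. -/

/-- The parallelogram obtained from `[a₁, b₁] × [a₂, b₂]` by tilting its top and bottom edges around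
their midpoints to slope `-γ`; its left and right edges are vertical. -/
def parallelogram (γ a₁ b₁ a₂ b₂ : ℝ) : Set (ℝ × ℝ) :=
  {μ | μ.1 ∈ Icc a₁ b₁ ∧ μ.2 + γ * (μ.1 - (a₁ + b₁) / 2) ∈ Icc a₂ b₂}

/-- `g` is a continuous, strictly positive probability density on the region `M` whose two partial
derivatives exist in the interior and are continuous up to the boundary of `M` (at some vertices of
`M` a partial derivative has no meaning of its own).  Values of `g` outside `M` play no role. -/
structure IsPriorDensity (M : Set (ℝ × ℝ)) (g : ℝ × ℝ → ℝ) : Prop where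
  pos : ∀ μ ∈ M, 0 < g μ
  continuousOn : ContinuousOn g M
  integral_eq_one : ∫ μ in M, g μ = 1
  partial_fst : ∃ g₁ : ℝ × ℝ → ℝ, ContinuousOn g₁ M ∧
    ∀ μ ∈ interior M, HasDerivAt (fun s => g (s, μ.2)) (g₁ μ) μ.1
  partial_snd : ∃ g₂ : ℝ × ℝ → ℝ, ContinuousOn g₂ M ∧
    ∀ μ ∈ interior M, HasDerivAt (fun s => g (μ.1, s)) (g₂ μ) μ.2

/-- A history of the stage game: the first draw, and the second draw or `none` if it is censored. -/
abbrev History : Type := ℝ × Option ℝ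

open Classical in
/-- The history that results from the potential draws `x = (x₁, x₂)` under the cutoff strategy that
stops iff `x₁ > c`. -/
def history (c : ℝ) (x : ℝ × ℝ) : History :=
  (x.1, if x.1 ≤ c then some x.2 else none)

/-- The likelihood of a history under `Ψ(μ₁, μ₂; γ)`. -/
def likelihood (γ : ℝ) (v : ℝ≥0) (μ : ℝ × ℝ) : History → ℝ
  | (x₁, none) => gaussianPDFReal μ.1 v x₁
  | (x₁, some x₂) => gaussianPDFReal μ.1 v x₁ * gaussianPDFReal (μ.2 - γ * (x₁ - μ.1)) v x₂

/-- The measure with density `g(μ) ∏_{s < t} likelihood(h s; μ)` on `M`, before normalization. -/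
def unnormalizedPosterior (γ : ℝ) (v : ℝ≥0) (M : Set (ℝ × ℝ)) (g : ℝ × ℝ → ℝ)
    (h : ℕ → History) (t : ℕ) : Measure (ℝ × ℝ) :=
  (volume.restrict M).withDensity fun μ =>
    ENNReal.ofReal (g μ * ∏ s ∈ Finset.range t, likelihood γ v μ (h s))

/-- The Bayesian posterior over fundamentals after the histories `h 0, …, h (t - 1)`, starting from
the prior density `g` on `M`. -/
def posterior (γ : ℝ) (v : ℝ≥0) (M : Set (ℝ × ℝ)) (g : ℝ × ℝ → ℝ)
    (h : ℕ → History) (t : ℕ) : Measure (ℝ × ℝ) :=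
  (unnormalizedPosterior γ v M g h t univ)⁻¹ • unnormalizedPosterior γ v M g h t

open Classical in
/-- The payoff of the cutoff strategy with threshold `c` at potential draws `x = (x₁, x₂)`. -/
def payoff (u₁ : ℝ → ℝ) (u₂ : ℝ → ℝ → ℝ) (c : ℝ) (x : ℝ × ℝ) : ℝ :=
  if x.1 ≤ c then u₂ x.1 x.2 else u₁ x.1

/-- The cutoff `c` maximizes the expected payoff, over all cutoffs, of an agent with belief `ν` over
the fundamentals: switching from any other cutoff `c'` to `c` has nonnegative expected gain.
The gain vanishes unless `x₁` lies between `c` and `c'`, so its expectation is finite for regular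
payoffs and beliefs on a bounded set, even where the two expected payoffs are not both finite;
where they are finite, it is their difference. -/
def IsOptimalCutoff (u₁ : ℝ → ℝ) (u₂ : ℝ → ℝ → ℝ) (γ : ℝ) (v : ℝ≥0)
    (ν : Measure (ℝ × ℝ)) (c : ℝ) : Prop :=
  ∀ c' : ℝ, 0 ≤ ∫ μ, (∫ x, (payoff u₁ u₂ c x - payoff u₁ u₂ c' x) ∂(subjectiveModel γ v μ)) ∂ν

/-- A sample path: `ω t = (X₁, X₂)` is the pair of potential draws in round `t = 0, 1, 2, …`. -/
abbrev SamplePath : Type := ℕ → ℝ × ℝ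

/-- The true law of the potential draws: all draws are independent, with `X₁ ∼ N(μ₁•, σ²)` and
`X₂ ∼ N(μ₂•, σ²)` in every round. -/
def trueLaw (v : ℝ≥0) (μt : ℝ × ℝ) : Measure SamplePath :=
  Measure.infinitePi fun _ : ℕ => (gaussianReal μt.1 v).prod (gaussianReal μt.2 v)

/-- The σ-algebra generated by the draws of the rounds `s < t`. -/
abbrev drawsBefore (t : ℕ) : MeasurableSpace SamplePath :=
  ⨆ s : Fin t, MeasurableSpace.comap (fun ω : SamplePath => ω s) inferInstance

/-- The posterior of agent `t` along the path `ω`, formed from the histories of all predecessors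
`s < t`, when agent `s` uses the cutoff `C s ω`. -/
def belief (γ : ℝ) (v : ℝ≥0) (M : Set (ℝ × ℝ)) (g : ℝ × ℝ → ℝ) (C : ℕ → SamplePath → ℝ)
    (t : ℕ) (ω : SamplePath) : Measure (ℝ × ℝ) :=
  posterior γ v M g (fun s => history (C s ω) (ω s)) t

/-- `C` is a process of cutoffs chosen by the agents: the cutoff of agent `t` is determined by the
draws of earlier rounds and maximizes her expected payoff under her posterior.  If there
are several maximizers, the selection is arbitrary. -/
structure IsCutoffProcess (u₁ : ℝ → ℝ) (u₂ : ℝ → ℝ → ℝ) (γ : ℝ) (v : ℝ≥0) (M : Set (ℝ × ℝ))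
    (g : ℝ × ℝ → ℝ) (C : ℕ → SamplePath → ℝ) : Prop where
  predictable : ∀ t, Measurable[drawsBefore t] (C t)
  optimal : ∀ t ω, IsOptimalCutoff u₁ u₂ γ v (belief γ v M g C t ω) (C t ω)

end GamblersFallacy

end

open GamblersFallacy

open GamblersFallacy

/-!
In the coordinates `(μ₁, θ)` with `θ = μ₂ + γ μ₁` the problem decouples. Under `Ψ(μ; γ)` the second
draw is `N(θ - γ x₁, σ²)` given `x₁`, so the optimal cutoff depends on `θ` alone, the
Kullback-Leibler divergence is a sum of a quadratic in `μ₁` and a quadratic in `θ`, the likelihood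
of a sample of histories is a Gaussian weight in `μ₁` times a Gaussian weight in `θ`, and the
parallelogram is a rectangle.

*Steady state.* Given a cutoff `c`, the divergence is minimal exactly at `μ₁ = μ₁•` and
`θ = θ*(c) := μ₂• + γ E[X₁ | X₁ ≤ c]` (`isPseudoTrue_iff`). A truncated Gaussian mean is a 1-Lipschitz
function of the truncation point (`abs_truncMean_sub_le`), so `θ*` is `γ`-Lipschitz, while the
second assumption on the payoffs makes the indifference point `C(θ)` an `l`-Lipschitz function of
`θ` with `l < 1 / γ` (`RegularPayoffs.indifference_sub_le`). Hence `C ∘ θ*` is a contraction of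
`ℝ`, and its fixed point is the unique steady state. Pessimism and early stopping follow from
`E[X₁ | X₁ ≤ c] < μ₁•` and `E[X₁ | X₁ ≤ c] < c`.

*Learning.* A strong law of large numbers for predictable cutoffs (`ae_tendsto_average_zero`, from
martingale convergence and Kronecker's lemma) shows that the peak of the likelihood in `θ` is
asymptotically an average of the values `θ*(C_s)` with weights `P(X₁ ≤ C_s)`, which are bounded
away from zero because optimal cutoffs stay in a compact set (`RegularPayoffs.cutoff_mem_Icc`). So
if the cutoffs are eventually within `L` of `c∞`, the peak is eventually within about `γ L` of
`θ∞`. The posterior concentrates at the projection of the peak onto the rectangle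
(`exists_posterior_concentration`), which is no farther from `θ∞`, and an optimal cutoff under a
concentrated belief is close to that of the point of concentration
(`RegularPayoffs.eventually_abs_cutoff_sub_le`); so the cutoffs are eventually within about `l γ L`
of `c∞`. As `l γ < 1`, iterating this bound gives convergence.
-/

namespace GamblersFallacy

/-! ### Gaussian averages of monotone functions -/

section GaussianAverage

variable {f : ℝ → ℝ} {v : ℝ≥0}

theorem integral_gaussianReal_shift (f : ℝ → ℝ) (m : ℝ) (v : ℝ≥0) :
    ∫ y, f y ∂gaussianReal m v = ∫ z, f (z + m) ∂gaussianReal 0 v := by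
  have := gaussianReal_map_add_const (μ := 0) (v := v) m
  rw [zero_add] at this
  rw [← this, (measurableEmbedding_addRight m).integral_map]

theorem integrable_gaussianReal_shift (hf : ∀ m, Integrable f (gaussianReal m v)) (m : ℝ) :
    Integrable (fun z => f (z + m)) (gaussianReal 0 v) := by
  have := gaussianReal_map_add_const (μ := 0) (v := v) m
  rw [zero_add] at this
  have h := hf m
  rw [← this, (measurableEmbedding_addRight m).integrable_map_iff] at h
  exact h

theorem integral_lt_integral_of_forall_lt {α : Type*} [MeasurableSpace α] {P : Measure α}
    [IsProbabilityMeasure P] {f g : α → ℝ} (hf : Integrable f P) (hg : Integrable g P)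
    (h : ∀ x, f x < g x) : ∫ x, f x ∂P < ∫ x, g x ∂P := by
  rw [← sub_pos, ← integral_sub hg hf, integral_pos_iff_support_of_nonneg
    (fun x => (sub_pos.2 (h x)).le) (hg.sub hf)]
  have : Function.support (fun x => g x - f x) = univ := by
    ext x; simp [(sub_pos.2 (h x)).ne']
  rw [this]; simp

theorem strictMono_gaussianAverage (hmono : StrictMono f)
    (hint : ∀ m, Integrable f (gaussianReal m v)) :
    StrictMono fun m => ∫ y, f y ∂gaussianReal m v := by
  intro m m' hm
  simp only [integral_gaussianReal_shift f]
  exact integral_lt_integral_of_forall_lt (integrable_gaussianReal_shift hint m)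
    (integrable_gaussianReal_shift hint m') fun z => hmono (by linarith)

theorem abs_le_of_monotone (hmono : Monotone f) {a b x : ℝ} (ha : a ≤ x) (hb : x ≤ b) :
    |f x| ≤ |f a| + |f b| := by
  have h1 := hmono ha
  have h2 := hmono hb
  rw [abs_le]
  constructor
  · linarith [neg_abs_le (f a), abs_nonneg (f b)]
  · linarith [le_abs_self (f b), abs_nonneg (f a)]

theorem continuous_gaussianAverage (hmono : Monotone f) (hcont : Continuous f)
    (hint : ∀ m, Integrable f (gaussianReal m v)) :
    Continuous fun m => ∫ y, f y ∂gaussianReal m v := by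
  simp only [integral_gaussianReal_shift f]
  refine continuous_iff_continuousAt.2 fun m => ?_
  refine continuousAt_of_dominated (bound := fun z => |f (z + (m - 1))| + |f (z + (m + 1))|)
    (Eventually.of_forall fun m' => (integrable_gaussianReal_shift hint m').1) ?_
    ((integrable_gaussianReal_shift hint _).abs.add (integrable_gaussianReal_shift hint _).abs)
    (Eventually.of_forall fun z => by fun_prop)
  filter_upwards [Icc_mem_nhds (show m - 1 < m by linarith) (show m < m + 1 by linarith)]
    with m' hm'
  exact Eventually.of_forall fun z =>
    abs_le_of_monotone hmono (by linarith [hm'.1]) (by linarith [hm'.2])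

/-- As `m → -∞`, the average of a monotone `f` under `N(m, σ²)` comes down to the infimum of `f`. -/
theorem exists_gaussianAverage_lt (hmono : Monotone f)
    (hint : ∀ m, Integrable f (gaussianReal m v)) {a b : ℝ} (hab : f a < b) :
    ∃ m, ∫ y, f y ∂gaussianReal m v < b := by
  simp only [integral_gaussianReal_shift f]
  have hi : ∀ n : ℕ, Integrable (fun z => max (f (z + (-n : ℝ))) (f a)) (gaussianReal 0 v) :=
    fun n => (integrable_gaussianReal_shift hint _).sup (integrable_const _)
  have hlim : Tendsto (fun n : ℕ => ∫ z, max (f (z + (-n : ℝ))) (f a) ∂gaussianReal 0 v) atTop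
      (𝓝 (∫ _, f a ∂gaussianReal 0 v)) := by
    refine tendsto_integral_of_dominated_convergence (fun z => |f (z + 0)| + |f a|)
      (fun n => (hi n).1)
      ((integrable_gaussianReal_shift hint _).abs.add (integrable_const _)) (fun n => ?_) ?_
    · refine Eventually.of_forall fun z => ?_
      have h1 : f (z + (-n : ℝ)) ≤ f (z + 0) :=
        hmono (by have : (0 : ℝ) ≤ n := n.cast_nonneg
                  linarith)
      rw [Real.norm_eq_abs, abs_le]
      constructor
      · linarith [le_max_right (f (z + (-n : ℝ))) (f a), neg_abs_le (f a), abs_nonneg (f (z + 0))]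
      · exact max_le (by linarith [le_abs_self (f (z + 0)), abs_nonneg (f a)])
          (by linarith [le_abs_self (f a), abs_nonneg (f (z + 0))])
    · refine Eventually.of_forall fun z => ?_
      refine tendsto_const_nhds.congr' ?_
      obtain ⟨N, hN⟩ := exists_nat_ge (z - a)
      filter_upwards [eventually_ge_atTop N] with n hn
      have : (N : ℝ) ≤ n := by exact_mod_cast hn
      exact (max_eq_right (hmono (by linarith))).symm
  have : ∫ _, f a ∂gaussianReal 0 v < b := by simpa using hab
  obtain ⟨n, hn⟩ := (hlim.eventually_lt_const this).exists
  exact ⟨-n, (integral_mono (integrable_gaussianReal_shift hint _) (hi n)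
    fun z => le_max_left _ _).trans_lt hn⟩

theorem exists_lt_gaussianAverage (hmono : Monotone f)
    (hint : ∀ m, Integrable f (gaussianReal m v)) {a b : ℝ} (hab : b < f a) :
    ∃ m, b < ∫ y, f y ∂gaussianReal m v := by
  have hneg : ∀ m, (gaussianReal m v).map (MeasurableEquiv.neg ℝ) = gaussianReal (-m) v :=
    fun m => gaussianReal_map_neg
  obtain ⟨m, hm⟩ := exists_gaussianAverage_lt (v := v) (f := fun x => -f (-x)) (a := -a) (b := -b)
    (fun x y hxy => neg_le_neg (hmono (neg_le_neg hxy)))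
    (fun m => by
      have h := hint (-m)
      rw [← hneg, (MeasurableEquiv.neg ℝ).measurableEmbedding.integrable_map_iff] at h
      exact h.neg) (by simpa using hab)
  refine ⟨-m, ?_⟩
  rw [← hneg, (MeasurableEquiv.neg ℝ).measurableEmbedding.integral_map]
  rw [integral_neg] at hm
  simpa using neg_lt_neg hm

end GaussianAverage

/-! ### Indifference between stopping and continuing -/

/-- Expected payoff of continuing after `x` when the second draw is `N(m, σ²)`. -/
noncomputable def expectedSecond (u₂ : ℝ → ℝ → ℝ) (v : ℝ≥0) (x m : ℝ) : ℝ :=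
  ∫ y, u₂ x y ∂gaussianReal m v

/-- The advantage of stopping over continuing after the first draw `x`.  Under `Ψ(μ; γ)` it depends
on the fundamentals only through the intercept `θ = μ₂ + γ μ₁` of the regression of `X₂` on
`X₁`. -/
noncomputable def stopGain (u₁ : ℝ → ℝ) (u₂ : ℝ → ℝ → ℝ) (γ : ℝ) (v : ℝ≥0) (θ x : ℝ) : ℝ :=
  u₁ x - expectedSecond u₂ v x (θ - γ * x)

section Payoffs

variable {u₁ : ℝ → ℝ} {u₂ : ℝ → ℝ → ℝ} {γ : ℝ} {v : ℝ≥0}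

theorem continuationPayoff_eq (μ : ℝ × ℝ) (x : ℝ) :
    continuationPayoff u₂ γ v μ x = expectedSecond u₂ v x (μ.2 + γ * μ.1 - γ * x) := by
  unfold continuationPayoff expectedSecond
  congr 2; ring

namespace RegularPayoffs

variable (h : RegularPayoffs u₁ u₂)
include h

theorem continuous_slice (x : ℝ) : Continuous (u₂ x) :=
  h.continuous_snd.comp (by fun_prop : Continuous fun y : ℝ => (x, y))

theorem abs_expectedSecond_sub_lt {x y : ℝ} (hxy : x < y) (m : ℝ) :
    |expectedSecond u₂ v y m - expectedSecond u₂ v x m| < u₁ y - u₁ x := by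
  unfold expectedSecond
  rw [← integral_sub (h.integrable y m v) (h.integrable x m v)]
  refine (abs_integral_le_integral_abs).trans_lt ?_
  have := integral_lt_integral_of_forall_lt (P := gaussianReal m v)
    ((h.integrable y m v).sub (h.integrable x m v)).abs (integrable_const (u₁ y - u₁ x))
    (fun z => h.abs_sub_lt x y z hxy)
  simpa using this

theorem abs_expectedSecond_sub_le (x y m : ℝ) :
    |expectedSecond u₂ v y m - expectedSecond u₂ v x m| ≤ |u₁ y - u₁ x| := by
  rcases lt_trichotomy x y with hxy | rfl | hxy
  · exact (h.abs_expectedSecond_sub_lt hxy m).le.trans (le_abs_self _)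
  · simp
  · rw [abs_sub_comm, abs_sub_comm (u₁ y)]
    exact (h.abs_expectedSecond_sub_lt hxy m).le.trans (le_abs_self _)

theorem strictMono_expectedSecond (x : ℝ) : StrictMono (expectedSecond u₂ v x) :=
  strictMono_gaussianAverage (h.strictMono_snd x) fun m => h.integrable x m v

theorem continuous_expectedSecond :
    Continuous fun p : ℝ × ℝ => expectedSecond u₂ v p.1 p.2 := by
  refine continuous_iff_continuousAt.2 fun p => ?_
  -- the dependence on `x` is controlled by `u₁` uniformly in `m`
  have h1 : Tendsto (fun q : ℝ × ℝ => |u₁ q.1 - u₁ p.1| +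
      |expectedSecond u₂ v p.1 q.2 - expectedSecond u₂ v p.1 p.2|) (𝓝 p) (𝓝 0) := by
    have hc : Continuous (expectedSecond u₂ v p.1) :=
      continuous_gaussianAverage (h.strictMono_snd p.1).monotone (h.continuous_slice _)
        fun m => h.integrable _ m v
    have hu := h.continuous_fst
    have : Continuous fun q : ℝ × ℝ => |u₁ q.1 - u₁ p.1| +
      |expectedSecond u₂ v p.1 q.2 - expectedSecond u₂ v p.1 p.2| := by fun_prop
    simpa using this.tendsto p
  rw [ContinuousAt, tendsto_iff_dist_tendsto_zero]
  refine squeeze_zero (fun _ => dist_nonneg) (fun q => ?_) h1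
  rw [Real.dist_eq]
  exact (abs_sub_le _ (expectedSecond u₂ v p.1 q.2) _).trans
    (add_le_add (h.abs_expectedSecond_sub_le _ _ _) le_rfl)

theorem continuous_stopGain :
    Continuous fun p : ℝ × ℝ => stopGain u₁ u₂ γ v p.1 p.2 := by
  unfold stopGain
  have hu := h.continuous_fst
  have := (h.continuous_expectedSecond (v := v)).comp
    (by fun_prop : Continuous fun p : ℝ × ℝ => (p.2, p.1 - γ * p.2))
  exact (hu.comp _root_.continuous_snd).sub this

theorem strictMono_stopGain (hγ : 0 ≤ γ) (θ : ℝ) : StrictMono (stopGain u₁ u₂ γ v θ) := by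
  intro x y hxy
  have h1 := (abs_lt.1 (h.abs_expectedSecond_sub_lt (v := v) hxy (θ - γ * x))).2
  have h2 : expectedSecond u₂ v y (θ - γ * y) ≤ expectedSecond u₂ v y (θ - γ * x) :=
    (h.strictMono_expectedSecond y).monotone
      (by linarith [mul_le_mul_of_nonneg_left hxy.le hγ])
  unfold stopGain
  linarith

theorem strictAnti_stopGain (x : ℝ) : StrictAnti fun θ => stopGain u₁ u₂ γ v θ x := by
  intro θ θ' hθ
  have := h.strictMono_expectedSecond (v := v) x (show θ - γ * x < θ' - γ * x by linarith)
  simp only [stopGain]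
  linarith

theorem exists_stopGain_pos (hγ : 0 < γ) (θ : ℝ) : ∃ x, 0 < stopGain u₁ u₂ γ v θ x := by
  obtain ⟨x₁, x₂, hx⟩ := RegularPayoffs.exists_stop h
  obtain ⟨m, hm⟩ := exists_gaussianAverage_lt (v := v) (h.strictMono_snd x₁).monotone
    (fun m => h.integrable x₁ m v) (show u₂ x₁ x₂ < u₁ x₁ by linarith)
  refine ⟨max (x₁ + 1) ((θ - m) / γ), ?_⟩
  set x := max (x₁ + 1) ((θ - m) / γ)
  have hx1 : x₁ < x := (lt_add_one _).trans_le (le_max_left _ _)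
  have hx2 : θ - γ * x ≤ m := by
    have : (θ - m) / γ ≤ x := le_max_right _ _
    rw [div_le_iff₀ hγ] at this
    linarith
  have h1 := (abs_lt.1 (h.abs_expectedSecond_sub_lt (v := v) hx1 m)).2
  have h2 := (h.strictMono_expectedSecond (v := v) x).monotone hx2
  change expectedSecond u₂ v x₁ m < u₁ x₁ at hm
  unfold stopGain
  linarith

theorem exists_stopGain_neg (hγ : 0 < γ) (θ : ℝ) : ∃ x, stopGain u₁ u₂ γ v θ x < 0 := by
  obtain ⟨x₁, x₂, hx⟩ := h.exists_continue
  obtain ⟨m, hm⟩ := exists_lt_gaussianAverage (v := v) (h.strictMono_snd x₁).monotone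
    (fun m => h.integrable x₁ m v) (show u₁ x₁ < u₂ x₁ x₂ by linarith)
  refine ⟨min (x₁ - 1) ((θ - m) / γ), ?_⟩
  set x := min (x₁ - 1) ((θ - m) / γ)
  have hx1 : x < x₁ := (min_le_left _ _).trans_lt (by linarith)
  have hx2 : m ≤ θ - γ * x := by
    have : x ≤ (θ - m) / γ := min_le_right _ _
    rw [le_div_iff₀ hγ] at this
    linarith
  have h1 := (abs_lt.1 (h.abs_expectedSecond_sub_lt (v := v) hx1 m)).2
  have h2 := (h.strictMono_expectedSecond (v := v) x).monotone hx2
  change u₁ x₁ < expectedSecond u₂ v x₁ m at hm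
  unfold stopGain
  linarith

theorem exists_stopGain_eq_zero (hγ : 0 < γ) (v : ℝ≥0) (θ : ℝ) :
    ∃ x, stopGain u₁ u₂ γ v θ x = 0 := by
  obtain ⟨a, ha⟩ := h.exists_stopGain_neg (v := v) hγ θ
  obtain ⟨b, hb⟩ := h.exists_stopGain_pos (v := v) hγ θ
  have hc : Continuous (stopGain u₁ u₂ γ v θ) :=
    (h.continuous_stopGain (γ := γ) (v := v)).comp
      (by fun_prop : Continuous fun x : ℝ => (θ, x))
  exact mem_range_of_exists_le_of_exists_ge hc ⟨a, ha.le⟩ ⟨b, hb.le⟩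

end RegularPayoffs

/-- The first draw that makes an agent with intercept `θ = μ₂ + γ μ₁` indifferent. -/
noncomputable def RegularPayoffs.indifference (h : RegularPayoffs u₁ u₂) (hγ : 0 < γ) (v : ℝ≥0)
    (θ : ℝ) : ℝ :=
  (h.exists_stopGain_eq_zero hγ v θ).choose

namespace RegularPayoffs

variable (h : RegularPayoffs u₁ u₂)
include h

theorem stopGain_indifference (hγ : 0 < γ) (θ : ℝ) :
    stopGain u₁ u₂ γ v θ (h.indifference hγ v θ) = 0 :=
  (h.exists_stopGain_eq_zero hγ v θ).choose_spec

theorem isModelCutoff_indifference (hγ : 0 < γ) (μ : ℝ × ℝ) :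
    IsModelCutoff u₁ u₂ γ v μ (h.indifference hγ v (μ.2 + γ * μ.1) : ℝ) := by
  have h0 := h.stopGain_indifference (v := v) hγ (μ.2 + γ * μ.1)
  constructor
  · intro x hx
    have := h.strictMono_stopGain (v := v) hγ.le (μ.2 + γ * μ.1) (EReal.coe_lt_coe_iff.1 hx)
    rw [continuationPayoff_eq, ← sub_neg]
    exact this.trans_eq h0
  · intro x hx
    have := h.strictMono_stopGain (v := v) hγ.le (μ.2 + γ * μ.1) (EReal.coe_lt_coe_iff.1 hx)
    rw [continuationPayoff_eq, ← sub_pos]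
    exact h0.symm.trans_lt this

theorem isModelCutoff_iff (hγ : 0 < γ) (μ : ℝ × ℝ) (c : ℝ) :
    IsModelCutoff u₁ u₂ γ v μ c ↔ c = h.indifference hγ v (μ.2 + γ * μ.1) := by
  refine ⟨fun hc => ?_, fun hc => hc ▸ h.isModelCutoff_indifference hγ μ⟩
  exact_mod_cast hc.unique (h.isModelCutoff_indifference hγ μ)

theorem strictMono_indifference (hγ : 0 < γ) : StrictMono (h.indifference hγ v) := by
  intro θ θ' hθ
  by_contra! hle
  have h1 := h.strictAnti_stopGain (γ := γ) (v := v) (h.indifference hγ v θ) hθ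
  have h2 := (h.strictMono_stopGain (v := v) hγ.le θ').monotone hle
  have h3 := h.stopGain_indifference (v := v) hγ θ
  have h4 := h.stopGain_indifference (v := v) hγ θ'
  simp only at h1
  linarith

/-- The Lipschitz condition on the payoffs, averaged over the second draw: raising the intercept by
`d` and the first draw by `l d` does not make stopping less attractive. -/
theorem stopGain_add_nonneg {l : ℝ} (hl : ∀ x₁ x₂ d : ℝ, 0 < d →
    u₂ (x₁ + l * d) (x₂ + (1 - γ * l) * d) - u₂ x₁ x₂ ≤ u₁ (x₁ + l * d) - u₁ x₁) {d : ℝ}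
    (hd : 0 < d) (θ x : ℝ) :
    stopGain u₁ u₂ γ v θ x ≤ stopGain u₁ u₂ γ v (θ + d) (x + l * d) := by
  have e : θ + d - γ * (x + l * d) = (θ - γ * x) + (1 - γ * l) * d := by ring
  unfold stopGain expectedSecond
  rw [e, integral_gaussianReal_shift, integral_gaussianReal_shift (u₂ (x + l * d))]
  have i1 := integrable_gaussianReal_shift (fun m => h.integrable x m v) (θ - γ * x)
  have i2 := integrable_gaussianReal_shift (fun m => h.integrable (x + l * d) m v)
    (θ - γ * x + (1 - γ * l) * d)
  have := integral_mono (i2.sub i1) (integrable_const (u₁ (x + l * d) - u₁ x)) fun z => by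
    have := hl x (z + (θ - γ * x)) d hd
    rwa [add_assoc z] at this
  simp only [Pi.sub_apply, integral_const, probReal_univ, one_smul] at this
  rw [integral_sub i2 i1] at this
  linarith

/-- Under the Lipschitz condition with constant `l`, the indifference point is an `l`-Lipschitz
function of the intercept. -/
theorem indifference_sub_le (hγ : 0 < γ) {l : ℝ} (hl : ∀ x₁ x₂ d : ℝ, 0 < d →
    u₂ (x₁ + l * d) (x₂ + (1 - γ * l) * d) - u₂ x₁ x₂ ≤ u₁ (x₁ + l * d) - u₁ x₁) (θ θ' : ℝ) :
    |h.indifference hγ v θ' - h.indifference hγ v θ| ≤ l * |θ' - θ| := by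
  wlog hθ : θ < θ' generalizing θ θ'
  · rcases eq_or_lt_of_le (not_lt.1 hθ) with rfl | hlt
    · simp
    · rw [abs_sub_comm, abs_sub_comm θ']; exact this _ _ hlt
  have hd : 0 < θ' - θ := sub_pos.2 hθ
  have h1 := h.stopGain_add_nonneg (v := v) hl hd θ (h.indifference hγ v θ)
  rw [h.stopGain_indifference, add_sub_cancel, ← h.stopGain_indifference (v := v) hγ θ'] at h1
  have h2 := (h.strictMono_stopGain (v := v) hγ.le θ').le_iff_le.1 h1
  rw [abs_of_pos (sub_pos.2 (h.strictMono_indifference hγ hθ)), abs_of_pos hd]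
  linarith

/-- For the unbiased model (`γ = 0`) the optimal cutoff exists in `[-∞, ∞]`. -/
theorem isModelCutoff_zero (μ : ℝ × ℝ) :
    IsModelCutoff u₁ u₂ 0 v μ
      (sSup ((fun x : ℝ => (x : EReal)) '' {x | stopGain u₁ u₂ 0 v μ.2 x < 0})) := by
  have e : ∀ x, continuationPayoff u₂ 0 v μ x = expectedSecond u₂ v x (μ.2 - 0 * x) := fun x => by
    rw [continuationPayoff_eq]; simp
  constructor
  · intro x hx
    obtain ⟨_, ⟨y, hy, rfl⟩, hxy⟩ := lt_sSup_iff.1 hx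
    have := h.strictMono_stopGain (v := v) le_rfl μ.2 (EReal.coe_lt_coe_iff.1 hxy)
    rw [e, ← sub_neg]
    exact this.trans hy
  · intro x hx
    obtain ⟨y, hy, hyx⟩ := EReal.lt_iff_exists_real_btwn.1 hx
    have h0 : 0 ≤ stopGain u₁ u₂ 0 v μ.2 y := by
      by_contra! hlt
      exact absurd hy (not_lt.2 (le_sSup ⟨y, hlt, rfl⟩))
    have := h.strictMono_stopGain (v := v) le_rfl μ.2 (EReal.coe_lt_coe_iff.1 hyx)
    rw [e, ← sub_pos]
    exact h0.trans_lt this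

/-- If continuing after `c` is strictly better in the unbiased model, then by continuity it is so
slightly above `c`, and the optimal cutoff lies strictly above `c`. -/
theorem exists_isModelCutoff_gt {μ : ℝ × ℝ} {c : ℝ} (hc : stopGain u₁ u₂ 0 v μ.2 c < 0) :
    ∃ copt : EReal, IsModelCutoff u₁ u₂ 0 v μ copt ∧ (c : EReal) < copt := by
  refine ⟨_, h.isModelCutoff_zero μ, ?_⟩
  have hcont : Continuous (stopGain u₁ u₂ 0 v μ.2) :=
    (h.continuous_stopGain (γ := 0) (v := v)).comp
      (by fun_prop : Continuous fun x : ℝ => (μ.2, x))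
  have h1 : ∀ᶠ x in 𝓝[>] c, stopGain u₁ u₂ 0 v μ.2 x < 0 :=
    (hcont.tendsto c).eventually_lt_const hc |>.filter_mono nhdsWithin_le_nhds
  obtain ⟨x, hx, hcx⟩ := (h1.and self_mem_nhdsWithin).exists
  exact (EReal.coe_lt_coe_iff.2 hcx).trans_le (le_sSup ⟨x, hx, rfl⟩)

end RegularPayoffs

end Payoffs

/-! ### Truncated Gaussian means -/

section Truncated

variable {v : ℝ≥0}

theorem setIntegral_gaussianReal (hv : 0 < v) (a : ℝ) {s : Set ℝ} (hs : MeasurableSet s)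
    (f : ℝ → ℝ) :
    ∫ x in s, f x ∂gaussianReal a v = ∫ x in s, gaussianPDFReal a v x * f x := by
  rw [← integral_indicator hs, integral_gaussianReal_eq_integral_smul hv.ne',
    ← integral_indicator hs]
  congr 1 with x
  by_cases hx : x ∈ s <;> simp [hx]

theorem integrable_gaussianReal_iff (hv : 0 < v) (a : ℝ) (f : ℝ → ℝ) :
    Integrable f (gaussianReal a v) ↔ Integrable fun x => gaussianPDFReal a v x * f x := by
  rw [gaussianReal_of_var_ne_zero _ hv.ne',
    integrable_withDensity_iff_integrable_smul' (measurable_gaussianPDF a v)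
      (Eventually.of_forall fun _ => gaussianPDF_lt_top)]
  simp [toReal_gaussianPDF]

theorem integrable_id_gaussianReal (a : ℝ) (v : ℝ≥0) :
    Integrable (fun x => x) (gaussianReal a v) :=
  (memLp_id_gaussianReal (μ := a) (v := v) 1).integrable (by simp)

theorem integrable_sq_gaussianReal (a : ℝ) (v : ℝ≥0) :
    Integrable (fun x => x ^ 2) (gaussianReal a v) :=
  (memLp_id_gaussianReal (μ := a) (v := v) 2).integrable_sq

theorem isOpenPosMeasure_gaussianReal (hv : 0 < v) (a : ℝ) :
    (gaussianReal a v).IsOpenPosMeasure :=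
  (gaussianReal_absolutelyContinuous' a hv.ne').isOpenPosMeasure

theorem gaussianReal_Iic_pos (hv : 0 < v) (a c : ℝ) : 0 < (gaussianReal a v).real (Iic c) := by
  have := isOpenPosMeasure_gaussianReal hv a
  rw [measureReal_def, ENNReal.toReal_pos_iff]
  exact ⟨((isOpen_Iio (a := c)).measure_pos _ nonempty_Iio).trans_le
    (measure_mono Iio_subset_Iic_self), measure_lt_top _ _⟩

/-- The mean of `N(a, σ²)` conditional on not exceeding `c`. -/
noncomputable def truncMean (a : ℝ) (v : ℝ≥0) (c : ℝ) : ℝ :=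
  (∫ x in Iic c, x ∂gaussianReal a v) / (gaussianReal a v).real (Iic c)

theorem setIntegral_sub_const (a c e : ℝ) :
    ∫ x in Iic c, (x - e) ∂gaussianReal a v =
      (∫ x in Iic c, x ∂gaussianReal a v) - (gaussianReal a v).real (Iic c) * e := by
  rw [integral_sub (integrable_id_gaussianReal a v).integrableOn (integrable_const _)]
  simp

theorem setIntegral_sub_eq (hv : 0 < v) (a c e : ℝ) :
    ∫ x in Iic c, (x - e) ∂gaussianReal a v =
      (gaussianReal a v).real (Iic c) * (truncMean a v c - e) := by
  rw [setIntegral_sub_const, mul_sub, truncMean,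
    mul_div_cancel₀ _ (gaussianReal_Iic_pos hv a c).ne']

theorem truncMean_lt (hv : 0 < v) (a c : ℝ) : truncMean a v c < c := by
  have := isOpenPosMeasure_gaussianReal hv a
  have hpos : 0 < ∫ x in Iic c, (c - x) ∂gaussianReal a v := by
    rw [setIntegral_pos_iff_support_of_nonneg_ae]
    · refine ((isOpen_Iio (a := c)).measure_pos (gaussianReal a v) nonempty_Iio).trans_le
        (measure_mono fun x hx => ⟨?_, (mem_Iio.1 hx).le⟩)
      exact (sub_pos.2 (mem_Iio.1 hx)).ne'
    · filter_upwards [ae_restrict_mem measurableSet_Iic] with x hx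
      exact sub_nonneg.2 hx
    · exact ((integrable_const c).sub (integrable_id_gaussianReal a v)).integrableOn
  have h1 := setIntegral_sub_eq hv a c c
  have h2 : ∫ x in Iic c, (c - x) ∂gaussianReal a v =
      -∫ x in Iic c, (x - c) ∂gaussianReal a v := by
    rw [← integral_neg]; simp
  rw [h2, h1] at hpos
  by_contra! hle
  have := mul_nonneg (gaussianReal_Iic_pos hv a c).le (sub_nonneg.2 hle)
  linarith

theorem truncMean_lt_mean (hv : 0 < v) (a c : ℝ) : truncMean a v c < a := by
  have := isOpenPosMeasure_gaussianReal hv a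
  rcases lt_or_ge c a with hca | hca
  · exact (truncMean_lt hv a c).trans hca
  have hint : Integrable (fun x => x - a) (gaussianReal a v) :=
    (integrable_id_gaussianReal a v).sub (integrable_const a)
  have hpos : 0 < ∫ x in Ioi c, (x - a) ∂gaussianReal a v := by
    rw [setIntegral_pos_iff_support_of_nonneg_ae]
    · refine ((isOpen_Ioi (a := c)).measure_pos (gaussianReal a v) nonempty_Ioi).trans_le
        (measure_mono fun x hx => ⟨?_, hx⟩)
      exact (sub_pos.2 (hca.trans_lt (mem_Ioi.1 hx))).ne'
    · filter_upwards [ae_restrict_mem measurableSet_Ioi] with x hx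
      exact sub_nonneg.2 (hca.trans (mem_Ioi.1 hx).le)
    · exact hint.integrableOn
  have h0 : ∫ x, (x - a) ∂gaussianReal a v = 0 := by
    rw [integral_sub (integrable_id_gaussianReal a v) (integrable_const a),
      integral_id_gaussianReal]
    simp
  have hadd := integral_add_compl (measurableSet_Iic (a := c)) hint
  rw [compl_Iic, h0, setIntegral_sub_eq hv] at hadd
  by_contra! hle
  have := mul_nonneg (gaussianReal_Iic_pos hv a c).le (sub_nonneg.2 hle)
  linarith

theorem truncMean_mono (hv : 0 < v) (a : ℝ) : Monotone (truncMean a v) := by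
  intro c c' hc
  have hint : Integrable (fun x => x - truncMean a v c) (gaussianReal a v) :=
    (integrable_id_gaussianReal a v).sub (integrable_const _)
  have h1 : 0 ≤ ∫ x in Ioc c c', (x - truncMean a v c) ∂gaussianReal a v :=
    setIntegral_nonneg measurableSet_Ioc fun x hx =>
      sub_nonneg.2 ((truncMean_lt hv a c).trans hx.1).le
  have h2 := setIntegral_sub_eq hv a c' (truncMean a v c)
  rw [← Iic_union_Ioc_eq_Iic hc, setIntegral_union (Iic_disjoint_Ioc le_rfl) measurableSet_Ioc
    hint.integrableOn hint.integrableOn, setIntegral_sub_eq hv, sub_self, mul_zero, zero_add,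
    Iic_union_Ioc_eq_Iic hc] at h2
  rw [h2] at h1
  exact sub_nonneg.1 (nonneg_of_mul_nonneg_right h1 (gaussianReal_Iic_pos hv a c'))

/-- A truncated Gaussian mean moves by less than the truncation point.  Translating by `d` tilts the
Gaussian density by a decreasing weight `w`, and averaging `y - E` against `w` instead of against a
constant can only lower the result, since `(y - E) (w y - w E) ≤ 0`. -/
theorem truncMean_add_le (hv : 0 < v) (a c : ℝ) {d : ℝ} (hd : 0 ≤ d) :
    truncMean a v (c + d) ≤ truncMean a v c + d := by
  set E := truncMean a v c with hE
  have hv' : (0 : ℝ) < v := hv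
  let w : ℝ → ℝ := fun y => Real.exp (-(2 * d * (y - a) + d ^ 2) / (2 * v))
  have hw : ∀ y, gaussianPDFReal a v (y + d) = gaussianPDFReal a v y * w y := by
    intro y
    simp only [gaussianPDFReal, w, mul_assoc, ← Real.exp_add]
    congr 3
    field_simp
    ring
  have hanti : Antitone w := by
    intro x y hxy
    refine Real.exp_le_exp.2 (div_le_div_of_nonneg_right ?_ (by positivity))
    linarith [mul_le_mul_of_nonneg_left hxy hd]
  have i1 : Integrable fun x => gaussianPDFReal a v x * (x - (E + d)) :=
    (integrable_gaussianReal_iff hv a _).1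
      ((integrable_id_gaussianReal a v).sub (integrable_const _))
  have i2 : Integrable fun x => gaussianPDFReal a v x * (x - E) :=
    (integrable_gaussianReal_iff hv a _).1
      ((integrable_id_gaussianReal a v).sub (integrable_const _))
  have h1 : ∫ x in Iic (c + d), gaussianPDFReal a v x * (x - (E + d)) =
      ∫ y in Iic c, gaussianPDFReal a v (y + d) * (y - E) := by
    rw [← integral_indicator measurableSet_Iic, ← integral_indicator measurableSet_Iic,
      ← integral_add_right_eq_self _ d]
    congr 1 with y
    by_cases hy : y ≤ c
    · rw [indicator_of_mem (by simpa using hy), indicator_of_mem (by simpa using hy)]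
      ring
    · rw [indicator_of_notMem (by simpa using hy), indicator_of_notMem (by simpa using hy)]
  have h2 : ∫ y in Iic c, gaussianPDFReal a v (y + d) * (y - E) ≤
      ∫ y in Iic c, w E * (gaussianPDFReal a v y * (y - E)) := by
    refine setIntegral_mono ?_ (i2.const_mul _).integrableOn fun y => ?_
    · have := i1.comp_add_right d
      simp only [add_sub_add_right_eq_sub] at this
      exact this.integrableOn
    · simp only [hw]
      have hp := gaussianPDFReal_nonneg a v y
      have : (y - E) * w y ≤ (y - E) * w E := by
        rcases le_total y E with hy | hy
        · exact mul_le_mul_of_nonpos_left (hanti hy) (sub_nonpos.2 hy)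
        · exact mul_le_mul_of_nonneg_left (hanti hy) (sub_nonneg.2 hy)
      linarith [mul_le_mul_of_nonneg_left this hp]
  rw [integral_const_mul, ← setIntegral_gaussianReal hv a measurableSet_Iic, setIntegral_sub_eq hv,
    ← hE, sub_self, mul_zero, mul_zero, ← h1,
    ← setIntegral_gaussianReal hv a measurableSet_Iic, setIntegral_sub_eq hv] at h2
  by_contra! hlt
  have := mul_pos (gaussianReal_Iic_pos hv a (c + d)) (sub_pos.2 hlt)
  linarith

theorem abs_truncMean_sub_le (hv : 0 < v) (a c c' : ℝ) :
    |truncMean a v c' - truncMean a v c| ≤ |c' - c| := by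
  wlog hc : c ≤ c' generalizing c c'
  · rw [abs_sub_comm, abs_sub_comm c']; exact this _ _ (le_of_not_ge hc)
  have h1 := truncMean_mono hv a hc
  have h2 := truncMean_add_le hv a c (sub_nonneg.2 hc)
  rw [add_sub_cancel] at h2
  rw [abs_of_nonneg (sub_nonneg.2 h1), abs_of_nonneg (sub_nonneg.2 hc)]
  linarith

end Truncated

/-! ### Pseudo-true fundamentals -/

/-- The intercept `θ = μ₂ + γ μ₁` that fits best the histories censored at `c`. -/
noncomputable def bestIntercept (γ : ℝ) (v : ℝ≥0) (μt : ℝ × ℝ) (c : ℝ) : ℝ :=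
  μt.2 + γ * truncMean μt.1 v c

section KL

variable {γ : ℝ} {v : ℝ≥0}

theorem log_gaussianPDFReal_div (hv : 0 < v) (a m x : ℝ) :
    Real.log (gaussianPDFReal a v x / gaussianPDFReal m v x) =
      (a - m) * (2 * x - a - m) / (2 * v) := by
  have hv' : (0 : ℝ) < v := hv
  have : gaussianPDFReal a v x / gaussianPDFReal m v x =
      Real.exp ((a - m) * (2 * x - a - m) / (2 * v)) := by
    unfold gaussianPDFReal
    rw [mul_div_mul_left _ _ (by positivity), ← Real.exp_sub]
    congr 1
    field_simp
    ring
  rw [this, Real.log_exp]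

theorem integral_affine_gaussianReal (a p q : ℝ) :
    ∫ x, (p * x + q) ∂gaussianReal a v = p * a + q := by
  rw [integral_add ((integrable_id_gaussianReal a v).const_mul p) (integrable_const q),
    integral_const_mul, integral_id_gaussianReal]
  simp

theorem integrable_affine_gaussianReal (a p q : ℝ) :
    Integrable (fun x => p * x + q) (gaussianReal a v) :=
  ((integrable_id_gaussianReal a v).const_mul p).add (integrable_const q)

theorem historyKL_eq_integral (hv : 0 < v) (μt : ℝ × ℝ) (c : ℝ) (μ : ℝ × ℝ) :
    historyKL γ v μt c μ = (μt.1 - μ.1) ^ 2 / (2 * v) +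
      ∫ x in Iic c, (μt.2 - (μ.2 + γ * μ.1) + γ * x) ^ 2 / (2 * v) ∂gaussianReal μt.1 v := by
  have hv' : (0 : ℝ) < v := hv
  -- the log-likelihood ratio of a single draw is affine in the draw
  let A : ℝ → ℝ := fun x => (μt.1 - μ.1) / v * x - (μt.1 - μ.1) * (μt.1 + μ.1) / (2 * v)
  let B : ℝ → ℝ := fun x => (μt.2 - (μ.2 + γ * μ.1) + γ * x) ^ 2 / (2 * v)
  have hA : ∀ x, Real.log (gaussianPDFReal μt.1 v x / gaussianPDFReal μ.1 v x) = A x := by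
    intro x
    rw [log_gaussianPDFReal_div hv]
    simp only [A]
    field_simp
    ring
  have iA : Integrable A (gaussianReal μt.1 v) := by
    simpa [A, sub_eq_add_neg] using integrable_affine_gaussianReal (v := v) μt.1
      ((μt.1 - μ.1) / v) (-((μt.1 - μ.1) * (μt.1 + μ.1) / (2 * v)))
  have iB : Integrable B (gaussianReal μt.1 v) := by
    have h1 : Integrable (fun x : ℝ => γ ^ 2 / (2 * v) * x ^ 2 +
        ((μt.2 - (μ.2 + γ * μ.1)) * γ / v * x + (μt.2 - (μ.2 + γ * μ.1)) ^ 2 / (2 * v)))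
        (gaussianReal μt.1 v) :=
      ((integrable_sq_gaussianReal μt.1 v).const_mul _).add (integrable_affine_gaussianReal _ _ _)
    refine h1.congr (Eventually.of_forall fun x => ?_)
    simp only [B]
    field_simp
    ring
  have hinner : ∀ x₁, ∫ x₂, gaussianPDFReal μt.1 v x₁ * gaussianPDFReal μt.2 v x₂ *
      Real.log ((gaussianPDFReal μt.1 v x₁ * gaussianPDFReal μt.2 v x₂) /
        (gaussianPDFReal μ.1 v x₁ * gaussianPDFReal (μ.2 - γ * (x₁ - μ.1)) v x₂)) =
      gaussianPDFReal μt.1 v x₁ * (A x₁ + B x₁) := by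
    intro x₁
    have hm : ∀ (m x : ℝ), gaussianPDFReal m v x ≠ 0 :=
      fun m x => (gaussianPDFReal_pos m v x hv.ne').ne'
    set m₂ := μ.2 - γ * (x₁ - μ.1) with hm₂
    have e : ∀ x₂, gaussianPDFReal μt.1 v x₁ * gaussianPDFReal μt.2 v x₂ *
        Real.log ((gaussianPDFReal μt.1 v x₁ * gaussianPDFReal μt.2 v x₂) /
        (gaussianPDFReal μ.1 v x₁ * gaussianPDFReal m₂ v x₂)) =
        gaussianPDFReal μt.1 v x₁ * (gaussianPDFReal μt.2 v x₂ •
          ((μt.2 - m₂) / v * x₂ + (A x₁ - (μt.2 - m₂) * (μt.2 + m₂) / (2 * v)))) := by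
      intro x₂
      rw [mul_div_mul_comm, Real.log_mul (div_ne_zero (hm _ _) (hm _ _))
        (div_ne_zero (hm _ _) (hm _ _)), hA, log_gaussianPDFReal_div hv, smul_eq_mul, mul_assoc]
      congr 2
      field_simp
      ring
    simp only [e]
    rw [integral_const_mul, ← integral_gaussianReal_eq_integral_smul hv.ne',
      integral_affine_gaussianReal]
    simp only [B, hm₂]
    congr 1
    field_simp
    ring
  unfold historyKL
  simp only [hinner, hA]
  rw [← setIntegral_gaussianReal hv _ measurableSet_Ioi,
    ← setIntegral_gaussianReal hv _ measurableSet_Iic,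
    integral_add iA.integrableOn iB.integrableOn, ← add_assoc, add_comm (∫ x in Ioi c, A x ∂_),
    ← compl_Iic, integral_add_compl measurableSet_Iic iA]
  congr 1
  have := integral_affine_gaussianReal (v := v) μt.1 ((μt.1 - μ.1) / v)
    (-((μt.1 - μ.1) * (μt.1 + μ.1) / (2 * v)))
  simp only [← sub_eq_add_neg] at this
  rw [this]
  field_simp
  ring

/-- Up to a constant, the divergence is quadratic in `μ₁` and in the intercept `μ₂ + γ μ₁`, without
a cross term. -/
theorem historyKL_eq (hv : 0 < v) (μt : ℝ × ℝ) (c : ℝ) : ∃ k : ℝ, ∀ μ : ℝ × ℝ,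
    historyKL γ v μt c μ = (μt.1 - μ.1) ^ 2 / (2 * v) +
      (gaussianReal μt.1 v).real (Iic c) * (bestIntercept γ v μt c - (μ.2 + γ * μ.1)) ^ 2 /
        (2 * v) + k := by
  have hv' : (0 : ℝ) < v := hv
  set E := truncMean μt.1 v c with hE
  set P := gaussianReal μt.1 v
  refine ⟨∫ x in Iic c, γ ^ 2 / (2 * v) * (x - E) ^ 2 ∂P, fun μ => ?_⟩
  rw [historyKL_eq_integral hv, add_assoc]
  congr 1
  set r := bestIntercept γ v μt c - (μ.2 + γ * μ.1) with hr
  have e : ∀ x : ℝ, (μt.2 - (μ.2 + γ * μ.1) + γ * x) ^ 2 / (2 * v) =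
      (r ^ 2 / (2 * v) + r * γ / v * (x - E)) + γ ^ 2 / (2 * v) * (x - E) ^ 2 := by
    intro x
    rw [hr, bestIntercept, ← hE]
    field_simp
    ring
  have i1 : Integrable (fun x => x - E) P :=
    (integrable_id_gaussianReal _ v).sub (integrable_const _)
  have i2 : Integrable (fun x => (x - E) ^ 2) P := by
    have h2 := ((integrable_sq_gaussianReal μt.1 v).add
      (integrable_affine_gaussianReal (v := v) μt.1 (-2 * E) (E ^ 2)))
    refine h2.congr (Eventually.of_forall fun x => ?_)
    simp only [Pi.add_apply]
    ring
  have i3 : Integrable (fun x => r ^ 2 / (2 * v) + r * γ / v * (x - E)) P :=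
    (integrable_const _).add (i1.const_mul _)
  simp only [e]
  rw [integral_add i3.integrableOn (i2.const_mul _).integrableOn]
  congr 1
  rw [integral_add (integrable_const _) (i1.const_mul _).integrableOn, integral_const_mul,
    setIntegral_sub_eq hv, ← hE]
  simp [P]
  ring

theorem isPseudoTrue_iff (hv : 0 < v) (μt : ℝ × ℝ) (c : ℝ) (μ : ℝ × ℝ) :
    IsPseudoTrue γ v μt c μ ↔ μ.1 = μt.1 ∧ μ.2 + γ * μ.1 = bestIntercept γ v μt c := by
  have hv' : (0 : ℝ) < v := hv
  have hP := gaussianReal_Iic_pos hv μt.1 c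
  obtain ⟨k, hk⟩ := historyKL_eq (γ := γ) hv μt c
  constructor
  · intro h
    have h1 := h (μt.1, bestIntercept γ v μt c - γ * μt.1)
    rw [hk, hk] at h1
    simp only [sub_self, sub_add_cancel, ne_eq, OfNat.ofNat_ne_zero, not_false_eq_true, zero_pow,
      mul_zero, zero_div, add_zero, zero_add, add_le_iff_nonpos_left] at h1
    have p1 : 0 ≤ (μt.1 - μ.1) ^ 2 / (2 * v) := by positivity
    have p2 : 0 ≤ (gaussianReal μt.1 v).real (Iic c) *
      (bestIntercept γ v μt c - (μ.2 + γ * μ.1)) ^ 2 / (2 * v) := by positivity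
    constructor
    · have : (μt.1 - μ.1) ^ 2 / (2 * v) = 0 := by linarith
      have : μt.1 - μ.1 = 0 := by
        rcases div_eq_zero_iff.1 this with h | h
        · exact pow_eq_zero_iff two_ne_zero |>.1 h
        · linarith
      linarith
    · have : (gaussianReal μt.1 v).real (Iic c) *
        (bestIntercept γ v μt c - (μ.2 + γ * μ.1)) ^ 2 / (2 * v) = 0 := by linarith
      have : bestIntercept γ v μt c - (μ.2 + γ * μ.1) = 0 := by
        rcases div_eq_zero_iff.1 this with h | h
        · rcases mul_eq_zero.1 h with h | h
          · exact absurd h hP.ne'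
          · exact pow_eq_zero_iff two_ne_zero |>.1 h
        · linarith
      linarith
  · rintro ⟨h1, h2⟩ μ'
    rw [hk, hk, h2, h1]
    simp only [sub_self, ne_eq, OfNat.ofNat_ne_zero, not_false_eq_true, zero_pow,
      mul_zero, zero_div, add_zero, zero_add, le_add_iff_nonneg_left]
    positivity

theorem abs_bestIntercept_sub_le (hγ : 0 < γ) (hv : 0 < v) (μt : ℝ × ℝ) (c c' : ℝ) :
    |bestIntercept γ v μt c' - bestIntercept γ v μt c| ≤ γ * |c' - c| := by
  unfold bestIntercept
  rw [add_sub_add_left_eq_sub, ← mul_sub, abs_mul, abs_of_pos hγ]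
  exact mul_le_mul_of_nonneg_left (abs_truncMean_sub_le hv _ _ _) hγ.le

end KL

/-! ### The steady state -/

section SteadyState

variable {u₁ : ℝ → ℝ} {u₂ : ℝ → ℝ → ℝ} {γ : ℝ} {v : ℝ≥0}

theorem RegularPayoffs.isSteadyState_iff (h : RegularPayoffs u₁ u₂) (hγ : 0 < γ) (hv : 0 < v)
    (μt μ : ℝ × ℝ) (c : ℝ) :
    IsSteadyState u₁ u₂ γ v μt μ c ↔
      μ = (μt.1, bestIntercept γ v μt c - γ * μt.1) ∧
        c = h.indifference hγ v (bestIntercept γ v μt c) := by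
  unfold IsSteadyState
  rw [h.isModelCutoff_iff hγ, isPseudoTrue_iff hv, Prod.ext_iff]
  constructor
  · rintro ⟨h1, h2, h3⟩
    refine ⟨⟨h2, ?_⟩, h3 ▸ h1⟩
    rw [← h3, ← h2]
    ring
  · rintro ⟨⟨h1, h2⟩, h3⟩
    have : μ.2 + γ * μ.1 = bestIntercept γ v μt c := by
      rw [h1, h2]
      ring
    exact ⟨by rwa [this], h1, this⟩

theorem RegularPayoffs.existsUnique_fixedPoint (h : RegularPayoffs u₁ u₂)
    (hlip : LipschitzPayoffs u₁ u₂ γ) (hγ : 0 < γ) (hv : 0 < v) (μt : ℝ × ℝ) :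
    ∃! c, c = h.indifference hγ v (bestIntercept γ v μt c) := by
  obtain ⟨l, hl0, hl1, hl⟩ := hlip
  have hq : γ * l < 1 := by
    rw [lt_div_iff₀ hγ] at hl1
    linarith
  have hcon : ContractingWith ⟨γ * l, by positivity⟩
      (fun c => h.indifference hγ v (bestIntercept γ v μt c)) := by
    refine ⟨hq, LipschitzWith.of_dist_le_mul fun c c' => ?_⟩
    rw [Real.dist_eq, Real.dist_eq]
    refine (h.indifference_sub_le hγ hl _ _).trans ?_
    have := mul_le_mul_of_nonneg_left (abs_bestIntercept_sub_le hγ hv μt c' c) hl0.le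
    refine this.trans_eq ?_
    change l * (γ * _) = γ * l * _
    ring
  refine ⟨hcon.fixedPoint, hcon.fixedPoint_isFixedPt.symm, fun c hc => ?_⟩
  exact hcon.fixedPoint_unique (x := c) hc.symm

/-- At the steady-state cutoff `c` the true mean of `X₂` exceeds the subjective one, because the
conditional mean of `X₁` given `X₁ ≤ c` is below `c`; so continuing is strictly better. -/
theorem RegularPayoffs.stopGain_zero_neg (h : RegularPayoffs u₁ u₂) (hγ : 0 < γ) (hv : 0 < v)
    (μt : ℝ × ℝ) {c : ℝ} (hc : c = h.indifference hγ v (bestIntercept γ v μt c)) :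
    stopGain u₁ u₂ 0 v μt.2 c < 0 := by
  have h0 := h.stopGain_indifference (v := v) hγ (bestIntercept γ v μt c)
  rw [← hc] at h0
  have hm : bestIntercept γ v μt c - γ * c < μt.2 - 0 * c := by
    unfold bestIntercept
    linarith [mul_lt_mul_of_pos_left (truncMean_lt hv μt.1 c) hγ]
  have := h.strictMono_expectedSecond (v := v) c hm
  unfold stopGain at h0 ⊢
  linarith

end SteadyState

/-! ### A strong law of large numbers under predictable censoring -/

/-- **Kronecker's lemma** for the weights `1 / (s + 1)`. -/
theorem tendsto_average_zero_of_tendsto_sum_div {a : ℕ → ℝ} {L : ℝ}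
    (h : Tendsto (fun n => ∑ s ∈ Finset.range n, a s / ((s : ℝ) + 1)) atTop (𝓝 L)) :
    Tendsto (fun n : ℕ => (n : ℝ)⁻¹ * ∑ s ∈ Finset.range n, a s) atTop (𝓝 0) := by
  set M : ℕ → ℝ := fun n => ∑ s ∈ Finset.range n, a s / ((s : ℝ) + 1)
  have habel : ∀ n : ℕ, ∑ s ∈ Finset.range n, a s = n * M n - ∑ s ∈ Finset.range n, M s := by
    intro n
    induction n with
    | zero => simp
    | succ n ih =>
      have hM : M (n + 1) = M n + a n / ((n : ℝ) + 1) := Finset.sum_range_succ _ _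
      rw [Finset.sum_range_succ, Finset.sum_range_succ, ih, hM]
      have : (n : ℝ) + 1 ≠ 0 := by positivity
      push_cast
      field_simp
      ring
  have h2 := h.sub h.cesaro
  rw [sub_self] at h2
  refine h2.congr' ?_
  filter_upwards [eventually_gt_atTop 0] with n hn
  have : (n : ℝ) ≠ 0 := by exact_mod_cast hn.ne'
  rw [habel n]
  field_simp

section LLN

theorem drawsBefore_mono : Monotone drawsBefore := fun _ t hst =>
  iSup_le fun r => le_iSup_of_le (⟨r, r.2.trans_le hst⟩ : Fin t) le_rfl

theorem drawsBefore_le (t : ℕ) : drawsBefore t ≤ (inferInstance : MeasurableSpace SamplePath) :=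
  iSup_le fun r => (measurable_pi_apply (r : ℕ)).comap_le

theorem measurable_draw {s t : ℕ} (hst : s < t) :
    Measurable[drawsBefore t] fun ω : SamplePath => ω s := by
  rw [measurable_iff_comap_le]
  exact le_iSup_of_le (⟨s, hst⟩ : Fin t) le_rfl

/-- The filtration generated by the potential draws. -/
def drawsFiltration : Filtration ℕ (inferInstance : MeasurableSpace SamplePath) where
  seq := drawsBefore
  mono' := drawsBefore_mono
  le' := drawsBefore_le

variable {Q : Measure (ℝ × ℝ)} [IsProbabilityMeasure Q]

theorem indep_drawsBefore (t : ℕ) :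
    Indep (drawsBefore t)
      (MeasurableSpace.comap (fun ω : SamplePath => ω t) inferInstance)
      (Measure.infinitePi fun _ : ℕ => Q) := by
  have h0 := iIndepFun_infinitePi (P := fun _ : ℕ => Q) (X := fun _ x => x)
    fun _ => measurable_id
  have h1 := indep_iSup_of_disjoint (fun i => (measurable_pi_apply i).comap_le) h0
    (S := {s | s < t}) (T := {t}) (by simp)
  simp only [mem_singleton_iff, iSup_iSup_eq_left] at h1
  refine indep_of_indep_of_le_left h1 ?_
  exact iSup_le fun r => le_iSup₂_of_le (r : ℕ) r.2 le_rfl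

/-- A function of a draw that is centred for every value of the parameter `c` stays uncorrelated
with the past when `c` is replaced by a predictable quantity. -/
theorem integral_mul_predictable_eq_zero {F : ℝ → ℝ × ℝ → ℝ}
    (hF : Measurable (Function.uncurry F)) (hF0 : ∀ c, ∫ x, F c x ∂Q = 0) {t : ℕ}
    {C G : SamplePath → ℝ} (hC : Measurable[drawsBefore t] C) (hG : Measurable[drawsBefore t] G) :
    ∫ ω, G ω * F (C ω) (ω t) ∂(Measure.infinitePi fun _ : ℕ => Q) = 0 := by
  set P : Measure SamplePath := Measure.infinitePi fun _ : ℕ => Q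
  have hle := drawsBefore_le t
  have hGC : Measurable[drawsBefore t] fun ω => (G ω, C ω) := hG.prodMk hC
  have hind : IndepFun (fun ω => (G ω, C ω)) (fun ω : SamplePath => ω t) P := by
    rw [IndepFun_iff_Indep]
    exact indep_of_indep_of_le_left (indep_drawsBefore t) hGC.comap_le
  have hGC' : Measurable fun ω => (G ω, C ω) := hGC.mono hle le_rfl
  have hmap := (indepFun_iff_map_prod_eq_prod_map_map hGC'.aemeasurable
    (measurable_pi_apply t).aemeasurable).1 hind
  rw [Measure.infinitePi_map_eval] at hmap
  have hΦ : Measurable fun p : (ℝ × ℝ) × (ℝ × ℝ) => p.1.1 * F p.1.2 p.2 := by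
    have := hF.comp (by fun_prop : Measurable fun p : (ℝ × ℝ) × (ℝ × ℝ) => (p.1.2, p.2))
    exact (by fun_prop : Measurable fun p : (ℝ × ℝ) × (ℝ × ℝ) => p.1.1).mul this
  have hprob := Measure.isProbabilityMeasure_map (μ := P) hGC'.aemeasurable
  have key : ∫ ω, G ω * F (C ω) (ω t) ∂P =
      ∫ p, p.1.1 * F p.1.2 p.2 ∂((P.map fun ω => (G ω, C ω)).prod Q) := by
    rw [← hmap, integral_map (hGC'.prodMk (measurable_pi_apply t)).aemeasurable
      hΦ.aestronglyMeasurable]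
  rw [key]
  by_cases hint : Integrable (fun p : (ℝ × ℝ) × (ℝ × ℝ) => p.1.1 * F p.1.2 p.2)
      ((P.map fun ω => (G ω, C ω)).prod Q)
  · rw [integral_prod _ hint]
    simp [integral_const_mul, hF0]
  · exact integral_undef hint

variable {F : ℝ → ℝ × ℝ → ℝ} {B : ℝ × ℝ → ℝ} {C : ℕ → SamplePath → ℝ}

theorem measurable_predictable_term (hF : Measurable (Function.uncurry F))
    (hC : ∀ t, Measurable[drawsBefore t] (C t)) {s t : ℕ} (hst : s < t) :
    Measurable[drawsBefore t] fun ω : SamplePath => F (C s ω) (ω s) :=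
  hF.comp (((hC s).mono (drawsBefore_mono hst.le) le_rfl).prodMk (measurable_draw hst))

theorem memLp_predictable_term (hF : Measurable (Function.uncurry F))
    (hC : ∀ t, Measurable[drawsBefore t] (C t)) (hB : MemLp B 2 Q)
    (hFB : ∀ c x, |F c x| ≤ B x) (s : ℕ) :
    MemLp (fun ω : SamplePath => F (C s ω) (ω s)) 2 (Measure.infinitePi fun _ : ℕ => Q) := by
  refine (hB.comp_measurePreserving (measurePreserving_eval_infinitePi (fun _ : ℕ => Q) s)).mono
    ((measurable_predictable_term hF hC (Nat.lt_succ_self s)).mono (drawsBefore_le _)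
      le_rfl).aestronglyMeasurable (Eventually.of_forall fun ω => ?_)
  exact (hFB _ _).trans (le_abs_self _)

/-- The martingale with increments `F (C s ω) (ω s) / (s + 1)`. -/
noncomputable def weightedSum (F : ℝ → ℝ × ℝ → ℝ) (C : ℕ → SamplePath → ℝ) (n : ℕ)
    (ω : SamplePath) : ℝ :=
  ∑ s ∈ Finset.range n, F (C s ω) (ω s) / ((s : ℝ) + 1)

theorem weightedSum_succ (n : ℕ) (ω : SamplePath) :
    weightedSum F C (n + 1) ω = weightedSum F C n ω + F (C n ω) (ω n) / ((n : ℝ) + 1) :=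
  Finset.sum_range_succ _ _

theorem measurable_weightedSum (hF : Measurable (Function.uncurry F))
    (hC : ∀ t, Measurable[drawsBefore t] (C t)) (n : ℕ) :
    Measurable[drawsBefore n] (weightedSum F C n) := by
  unfold weightedSum
  exact Finset.measurable_fun_sum (Finset.range n) fun s hs =>
    (measurable_predictable_term hF hC (Finset.mem_range.1 hs)).div_const _

theorem memLp_weightedSum (hF : Measurable (Function.uncurry F))
    (hC : ∀ t, Measurable[drawsBefore t] (C t)) (hB : MemLp B 2 Q)
    (hFB : ∀ c x, |F c x| ≤ B x) (n : ℕ) :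
    MemLp (weightedSum F C n) 2 (Measure.infinitePi fun _ : ℕ => Q) := by
  unfold weightedSum
  refine memLp_finsetSum _ fun s _ => ?_
  simp only [div_eq_inv_mul]
  exact (memLp_predictable_term hF hC hB hFB s).const_mul _

theorem integral_sq_weightedSum_le (hF : Measurable (Function.uncurry F))
    (hF0 : ∀ c, ∫ x, F c x ∂Q = 0)
    (hC : ∀ t, Measurable[drawsBefore t] (C t)) (hB : MemLp B 2 Q)
    (hFB : ∀ c x, |F c x| ≤ B x) (n : ℕ) :
    ∫ ω, weightedSum F C n ω ^ 2 ∂(Measure.infinitePi fun _ : ℕ => Q) ≤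
      (∫ x, B x ^ 2 ∂Q) * ∑ s ∈ Finset.range n, 1 / ((s : ℝ) + 1) ^ 2 := by
  induction n with
  | zero => simp [weightedSum]
  | succ n ih =>
    set P : Measure SamplePath := Measure.infinitePi fun _ : ℕ => Q
    have hM := memLp_weightedSum hF hC hB hFB n
    have hX := memLp_predictable_term hF hC hB hFB n
    have hBω : Integrable (fun ω : SamplePath => B (ω n) ^ 2) P :=
      (hB.comp_measurePreserving
        (measurePreserving_eval_infinitePi (fun _ : ℕ => Q) n)).integrable_sq
    have e : ∀ ω, weightedSum F C (n + 1) ω ^ 2 = weightedSum F C n ω ^ 2 +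
        (2 / ((n : ℝ) + 1) * (weightedSum F C n ω * F (C n ω) (ω n)) +
          1 / ((n : ℝ) + 1) ^ 2 * F (C n ω) (ω n) ^ 2) := fun ω => by
      rw [weightedSum_succ]
      field_simp
      ring
    simp only [e]
    have i1 : Integrable (fun ω => weightedSum F C n ω * F (C n ω) (ω n)) P :=
      hM.integrable_mul hX
    have i2 : Integrable (fun ω => 2 / ((n : ℝ) + 1) * (weightedSum F C n ω * F (C n ω) (ω n)) +
        1 / ((n : ℝ) + 1) ^ 2 * F (C n ω) (ω n) ^ 2) P :=
      (i1.const_mul _).add (hX.integrable_sq.const_mul _)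
    rw [integral_add hM.integrable_sq i2,
      integral_add (i1.const_mul _) (hX.integrable_sq.const_mul _), integral_const_mul,
      integral_mul_predictable_eq_zero hF hF0 (hC n) (measurable_weightedSum hF hC n), mul_zero,
      zero_add, integral_const_mul, Finset.sum_range_succ, mul_add]
    refine add_le_add ih ?_
    rw [mul_comm]
    refine mul_le_mul_of_nonneg_right ?_ (by positivity)
    calc ∫ ω, F (C n ω) (ω n) ^ 2 ∂P ≤ ∫ ω, B (ω n) ^ 2 ∂P :=
          integral_mono hX.integrable_sq hBω fun ω =>
            sq_le_sq.2 ((hFB _ _).trans (le_abs_self _))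
      _ = ∫ x, B x ^ 2 ∂Q := by
          rw [← Measure.infinitePi_map_eval (fun _ : ℕ => Q) n,
            integral_map (measurable_pi_apply n).aemeasurable]
          rw [Measure.infinitePi_map_eval]
          exact hB.1.pow 2

theorem martingale_weightedSum (hF : Measurable (Function.uncurry F))
    (hF0 : ∀ c, ∫ x, F c x ∂Q = 0)
    (hC : ∀ t, Measurable[drawsBefore t] (C t)) (hB : MemLp B 2 Q)
    (hFB : ∀ c x, |F c x| ≤ B x) :
    Martingale (weightedSum F C) drawsFiltration (Measure.infinitePi fun _ : ℕ => Q) := by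
  set P : Measure SamplePath := Measure.infinitePi fun _ : ℕ => Q
  refine martingale_of_setIntegral_eq_succ
    (fun n => (measurable_weightedSum hF hC n).stronglyMeasurable)
    (fun n => (memLp_weightedSum hF hC hB hFB n).integrable one_le_two) fun n A hA => ?_
  have hA' : MeasurableSet A := drawsBefore_le n _ hA
  have hX := (memLp_predictable_term hF hC hB hFB n).integrable one_le_two
  have h0 := integral_mul_predictable_eq_zero (Q := Q) hF hF0 (hC n)
    ((measurable_const (a := (1 : ℝ))).indicator hA)
  have h1 : ∫ ω in A, F (C n ω) (ω n) ∂P = 0 := by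
    rw [← integral_indicator hA', ← h0]
    congr 1 with ω
    by_cases hω : ω ∈ A <;> simp [hω]
  simp only [weightedSum_succ]
  rw [integral_add ((memLp_weightedSum hF hC hB hFB n).integrable one_le_two).integrableOn
    (hX.div_const _).integrableOn, integral_div, h1, zero_div, add_zero]

/-- **Strong law of large numbers** for a predictable choice of parameters: the averages of
`F (C s ω) (ω s)` vanish in the limit if `F c` is centred for every `c` and the functions `F c` have
a common square-integrable bound. -/
theorem ae_tendsto_average_zero (hF : Measurable (Function.uncurry F))
    (hF0 : ∀ c, ∫ x, F c x ∂Q = 0)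
    (hC : ∀ t, Measurable[drawsBefore t] (C t)) (hB : MemLp B 2 Q)
    (hFB : ∀ c x, |F c x| ≤ B x) :
    ∀ᵐ ω ∂(Measure.infinitePi fun _ : ℕ => Q),
      Tendsto (fun n : ℕ => (n : ℝ)⁻¹ * ∑ s ∈ Finset.range n, F (C s ω) (ω s)) atTop (𝓝 0) := by
  set P : Measure SamplePath := Measure.infinitePi fun _ : ℕ => Q
  have hsum : Summable fun s : ℕ => 1 / ((s : ℝ) + 1) ^ 2 := by
    have := (summable_nat_add_iff 1).2 (Real.summable_one_div_nat_pow.2 one_lt_two)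
    simpa using this
  set K := (∫ x, B x ^ 2 ∂Q) * ∑' s : ℕ, 1 / ((s : ℝ) + 1) ^ 2
  have hK0 : 0 ≤ ∫ x, B x ^ 2 ∂Q := integral_nonneg fun _ => sq_nonneg _
  have hbdd : ∀ n, eLpNorm (weightedSum F C n) 1 P ≤ (1 + K).toNNReal := by
    intro n
    have hM := memLp_weightedSum hF hC hB hFB n
    have h1 : ∫ ω, ‖weightedSum F C n ω‖ ∂P ≤ 1 + K := by
      calc ∫ ω, ‖weightedSum F C n ω‖ ∂P ≤ ∫ ω, (1 + weightedSum F C n ω ^ 2) ∂P := by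
            refine integral_mono (hM.integrable one_le_two).norm
              ((integrable_const _).add hM.integrable_sq) fun ω => ?_
            simp only [Real.norm_eq_abs]
            nlinarith [sq_abs (weightedSum F C n ω), sq_nonneg (|weightedSum F C n ω| - 1),
              abs_nonneg (weightedSum F C n ω)]
        _ = 1 + ∫ ω, weightedSum F C n ω ^ 2 ∂P := by
            rw [integral_add (integrable_const _) hM.integrable_sq]; simp [P]
        _ ≤ 1 + K := by
            gcongr
            exact (integral_sq_weightedSum_le hF hF0 hC hB hFB n).trans
              (mul_le_mul_of_nonneg_left (hsum.sum_le_tsum _ fun _ _ => by positivity) hK0)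
    rw [eLpNorm_one_eq_lintegral_enorm,
      ← ofReal_integral_norm_eq_lintegral_enorm (hM.integrable one_le_two)]
    exact ENNReal.ofReal_le_ofReal h1
  filter_upwards [(martingale_weightedSum hF hF0 hC hB hFB).submartingale.exists_ae_tendsto_of_bdd
    hbdd] with ω hω
  obtain ⟨L, hL⟩ := hω
  exact tendsto_average_zero_of_tendsto_sum_div hL

/-- Averages of `f` over the uncensored rounds are asymptotically the averages of its truncated
expectations at the cutoffs in use. -/
theorem ae_tendsto_censored_average {f : ℝ × ℝ → ℝ} (hf : Measurable f) (hf2 : MemLp f 2 Q)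
    (hC : ∀ t, Measurable[drawsBefore t] (C t)) :
    ∀ᵐ ω ∂(Measure.infinitePi fun _ : ℕ => Q),
      Tendsto (fun n : ℕ => (n : ℝ)⁻¹ * ∑ s ∈ Finset.range n,
        ({x : ℝ × ℝ | x.1 ≤ C s ω}.indicator f (ω s) - ∫ x in {x | x.1 ≤ C s ω}, f x ∂Q))
        atTop (𝓝 0) := by
  have hmeas : ∀ c : ℝ, MeasurableSet {x : ℝ × ℝ | x.1 ≤ c} := fun c =>
    measurableSet_le measurable_fst measurable_const
  have hfi : Integrable f Q := hf2.integrable one_le_two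
  have hind : Measurable fun p : ℝ × (ℝ × ℝ) => {x : ℝ × ℝ | x.1 ≤ p.1}.indicator f p.2 := by
    have : (fun p : ℝ × (ℝ × ℝ) => {x : ℝ × ℝ | x.1 ≤ p.1}.indicator f p.2) =
        {p : ℝ × (ℝ × ℝ) | p.2.1 ≤ p.1}.indicator fun p => f p.2 := by
      ext p; simp [indicator]
    rw [this]
    exact (hf.comp measurable_snd).indicator
      (measurableSet_le (measurable_fst.comp measurable_snd) measurable_fst)
  have hκ : Measurable fun c : ℝ => ∫ x in {x : ℝ × ℝ | x.1 ≤ c}, f x ∂Q := by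
    simp only [← integral_indicator (hmeas _)]
    exact hind.stronglyMeasurable.integral_prod_right.measurable
  refine ae_tendsto_average_zero
    (F := fun c x => {x : ℝ × ℝ | x.1 ≤ c}.indicator f x - ∫ x in {x | x.1 ≤ c}, f x ∂Q)
    (B := fun x => |f x| + ∫ x, |f x| ∂Q) ?_ (fun c => ?_) hC
    (hf2.abs.add (memLp_const _)) fun c x => ?_
  · exact hind.sub (hκ.comp measurable_fst)
  · rw [integral_sub (hfi.indicator (hmeas c)) (integrable_const _), integral_indicator (hmeas c)]
    simp
  · refine (abs_sub _ _).trans (add_le_add ?_ ?_)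
    · simp only [indicator]
      split_ifs <;> simp
    · exact abs_integral_le_integral_abs.trans
        (setIntegral_le_integral hfi.abs (Eventually.of_forall fun _ => abs_nonneg _))

end LLN

/-! ### Concentration of quadratic exponential weights on an interval -/

/-- The point of `[α, β]` nearest to `y`. -/
def clamp (α β y : ℝ) : ℝ := max α (min y β)

theorem clamp_mem {α β : ℝ} (h : α ≤ β) (y : ℝ) : clamp α β y ∈ Icc α β :=
  ⟨le_max_left _ _, max_le h (min_le_right _ _)⟩

theorem abs_clamp_sub_le {α β p : ℝ} (hp : p ∈ Icc α β) (y : ℝ) :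
    |clamp α β y - p| ≤ |y - p| := by
  obtain ⟨h1, h2⟩ := hp
  unfold clamp
  rcases le_total y β with hy | hy
  · rw [min_eq_left hy]
    rcases le_total α y with hy' | hy'
    · rw [max_eq_right hy']
    · rw [max_eq_left hy', abs_of_nonpos (by linarith), abs_of_nonpos (by linarith)]
      linarith
  · rw [min_eq_right hy, max_eq_right (h1.trans h2), abs_of_nonneg (by linarith),
      abs_of_nonneg (by linarith)]
    linarith

/-- The obtuse-angle property of the projection onto an interval. -/
theorem sq_clamp_add_sq_le {α β θ : ℝ} (hθ : θ ∈ Icc α β) (y : ℝ) :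
    (clamp α β y - y) ^ 2 + (θ - clamp α β y) ^ 2 ≤ (θ - y) ^ 2 := by
  have hle := hθ.1.trans hθ.2
  obtain ⟨h1, h2⟩ := hθ
  have key : 0 ≤ (θ - clamp α β y) * (clamp α β y - y) := by
    unfold clamp
    rcases le_total y β with hy | hy
    · rw [min_eq_left hy]
      rcases le_total α y with hy' | hy'
      · rw [max_eq_right hy', sub_self, mul_zero]
      · rw [max_eq_left hy']
        exact mul_nonneg (by linarith) (by linarith)
    · rw [min_eq_right hy, max_eq_right hle]
      exact mul_nonneg_of_nonpos_of_nonpos (by linarith) (by linarith)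
  nlinarith

/-- As `b → ∞`, the weight `exp (-b (θ - y)²)` on `[α, β]` concentrates around the point of the
interval nearest to `y`, uniformly over bounded `y`. -/
theorem exists_concentration {α β : ℝ} (hαβ : α < β) (R : ℝ) {ε δ : ℝ} (hε : 0 < ε) (hδ : 0 < δ) :
    ∃ b₀ : ℝ, ∀ b ≥ b₀, ∀ y : ℝ, |y| ≤ R →
      ∫⁻ θ in Icc α β ∩ {θ | ε ≤ |θ - clamp α β y|}, ENNReal.ofReal (Real.exp (-b * (θ - y) ^ 2)) ≤
        ENNReal.ofReal δ *
          ∫⁻ θ in Icc α β, ENNReal.ofReal (Real.exp (-b * (θ - y) ^ 2)) := by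
  set D := |R| + |α| + |β| with hD
  have hD0 : 0 ≤ D := by positivity
  set e := min 1 (ε ^ 2 / (2 * (2 * D + 1))) with he
  have he0 : 0 < e := lt_min one_pos (by positivity)
  have he1 : e ≤ 1 := min_le_left _ _
  have he2 : e * (2 * D + 1) ≤ ε ^ 2 / 2 := by
    have : e ≤ ε ^ 2 / (2 * (2 * D + 1)) := min_le_right _ _
    rw [le_div_iff₀ (by positivity)] at this
    linarith
  set m := min e ((β - α) / 2) with hm
  have hm0 : 0 < m := lt_min he0 (by linarith)
  have hlim : Tendsto (fun b : ℝ => Real.exp (-(b * (ε ^ 2 / 2)))) atTop (𝓝 0) :=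
    Real.tendsto_exp_neg_atTop_nhds_zero.comp (tendsto_id.atTop_mul_const (by positivity))
  have hsmall : ∀ᶠ b : ℝ in atTop, Real.exp (-(b * (ε ^ 2 / 2))) < δ * m / (β - α) :=
    hlim.eventually_lt_const (div_pos (by positivity) (by linarith))
  obtain ⟨b₁, hb₁⟩ := eventually_atTop.1 hsmall
  refine ⟨max b₁ 0, fun b hb y hy => ?_⟩
  have hb0 : 0 ≤ b := (le_max_right _ _).trans hb
  have hbs := hb₁ b ((le_max_left _ _).trans hb)
  rw [lt_div_iff₀ (by linarith)] at hbs
  set p := clamp α β y with hp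
  have hpm : p ∈ Icc α β := clamp_mem hαβ.le y
  have hpy : |p - y| ≤ D := by
    have h1 : |p| ≤ |α| + |β| := abs_le_of_monotone monotone_id hpm.1 hpm.2
    have := abs_sub p y
    linarith [le_abs_self R]
  have hbad : ∫⁻ θ in Icc α β ∩ {θ | ε ≤ |θ - p|}, ENNReal.ofReal (Real.exp (-b * (θ - y) ^ 2)) ≤
      ENNReal.ofReal (Real.exp (-b * ((p - y) ^ 2 + ε ^ 2)) * (β - α)) := by
    calc _ ≤ ∫⁻ _ in Icc α β ∩ {θ | ε ≤ |θ - p|},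
          ENNReal.ofReal (Real.exp (-b * ((p - y) ^ 2 + ε ^ 2))) := by
          refine setLIntegral_mono measurable_const fun θ hθ => ENNReal.ofReal_le_ofReal
            (Real.exp_le_exp.2 ?_)
          have h1 := sq_clamp_add_sq_le hθ.1 y
          have h2 : ε ^ 2 ≤ (θ - p) ^ 2 := by
            rw [← sq_abs (θ - p)]
            exact pow_le_pow_left₀ hε.le hθ.2 2
          rw [← hp] at h1
          linarith [mul_le_mul_of_nonneg_left (h1.trans' (add_le_add_right h2 _)) hb0]
      _ ≤ ENNReal.ofReal (Real.exp (-b * ((p - y) ^ 2 + ε ^ 2))) * volume (Icc α β) := by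
          rw [setLIntegral_const]
          gcongr
          exact inter_subset_left
      _ = _ := by rw [Real.volume_Icc, ← ENNReal.ofReal_mul (Real.exp_nonneg _)]
  obtain ⟨s, hs, hsub, hvol⟩ : ∃ s : Set ℝ, (∀ θ ∈ s, |θ - p| ≤ e) ∧ s ⊆ Icc α β ∧
      volume s = ENNReal.ofReal m := by
    rcases le_total p ((α + β) / 2) with hpc | hpc
    · refine ⟨Icc p (p + m), fun θ hθ => ?_, fun θ hθ => ⟨hpm.1.trans hθ.1, ?_⟩, by simp⟩
      · rw [abs_of_nonneg (by linarith [hθ.1])]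
        linarith [hθ.2, min_le_left e ((β - α) / 2)]
      · linarith [hθ.2, min_le_right e ((β - α) / 2)]
    · refine ⟨Icc (p - m) p, fun θ hθ => ?_, fun θ hθ => ⟨?_, hθ.2.trans hpm.2⟩, by simp⟩
      · rw [abs_of_nonpos (by linarith [hθ.2])]
        linarith [hθ.1, min_le_left e ((β - α) / 2)]
      · linarith [hθ.1, min_le_right e ((β - α) / 2)]
  have hgood : ENNReal.ofReal (Real.exp (-b * ((p - y) ^ 2 + ε ^ 2 / 2)) * m) ≤
      ∫⁻ θ in Icc α β, ENNReal.ofReal (Real.exp (-b * (θ - y) ^ 2)) := by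
    calc _ = ∫⁻ _ in s, ENNReal.ofReal (Real.exp (-b * ((p - y) ^ 2 + ε ^ 2 / 2))) := by
          rw [setLIntegral_const, hvol, ← ENNReal.ofReal_mul (Real.exp_nonneg _)]
      _ ≤ ∫⁻ θ in s, ENNReal.ofReal (Real.exp (-b * (θ - y) ^ 2)) := by
          refine setLIntegral_mono (by fun_prop) fun θ hθ => ENNReal.ofReal_le_ofReal
            (Real.exp_le_exp.2 ?_)
          have h1 : |θ - y| ≤ |p - y| + e := by
            have := abs_sub_le θ p y
            linarith [hs θ hθ]
          have h2 : (θ - y) ^ 2 ≤ (p - y) ^ 2 + ε ^ 2 / 2 := by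
            rw [← sq_abs (θ - y), ← sq_abs (p - y)]
            have h3 := pow_le_pow_left₀ (abs_nonneg _) h1 2
            have h4 := mul_le_mul_of_nonneg_left hpy he0.le
            have h5 := mul_le_mul_of_nonneg_left he1 he0.le
            nlinarith
          linarith [mul_le_mul_of_nonneg_left h2 hb0]
      _ ≤ _ := lintegral_mono_set hsub
  refine hbad.trans ((mul_le_mul_right hgood _).trans' ?_)
  rw [← ENNReal.ofReal_mul hδ.le]
  refine ENNReal.ofReal_le_ofReal ?_
  have e1 : Real.exp (-b * ((p - y) ^ 2 + ε ^ 2)) =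
      Real.exp (-b * ((p - y) ^ 2 + ε ^ 2 / 2)) * Real.exp (-(b * (ε ^ 2 / 2))) := by
    rw [← Real.exp_add]
    congr 1
    ring
  rw [e1]
  have := mul_le_mul_of_nonneg_left hbs.le (Real.exp_nonneg (-b * ((p - y) ^ 2 + ε ^ 2 / 2)))
  linarith

/-! ### Posteriors on a parallelogram -/

section Posterior

variable {γ : ℝ} {v : ℝ≥0}

/-- The fundamentals with `μ₁ ∈ I` and intercept `μ₂ + γ μ₁ ∈ J`. -/
def sheared (γ : ℝ) (I J : Set ℝ) : Set (ℝ × ℝ) :=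
  {μ | μ.1 ∈ I ∧ μ.2 + γ * μ.1 ∈ J}

theorem parallelogram_eq_sheared (γ a₁ b₁ a₂ b₂ : ℝ) :
    parallelogram γ a₁ b₁ a₂ b₂ = sheared γ (Icc a₁ b₁)
      (Icc (a₂ + γ * ((a₁ + b₁) / 2)) (b₂ + γ * ((a₁ + b₁) / 2))) := by
  ext μ
  simp only [parallelogram, sheared, mem_ofPred_eq, mem_Icc]
  refine and_congr Iff.rfl (and_congr ?_ ?_) <;> constructor <;> intro h <;> linarith

theorem measurableSet_sheared {I J : Set ℝ} (hI : MeasurableSet I) (hJ : MeasurableSet J) :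
    MeasurableSet (sheared γ I J) :=
  (measurable_fst hI).inter
    ((by fun_prop : Measurable fun μ : ℝ × ℝ => μ.2 + γ * μ.1) hJ)

theorem isCompact_sheared (γ a b α β : ℝ) : IsCompact (sheared γ (Icc a b) (Icc α β)) := by
  have : sheared γ (Icc a b) (Icc α β) =
      (fun p : ℝ × ℝ => (p.1, p.2 - γ * p.1)) '' (Icc a b ×ˢ Icc α β) := by
    ext μ
    constructor
    · rintro ⟨h1, h2⟩
      exact ⟨(μ.1, μ.2 + γ * μ.1), ⟨h1, h2⟩, by simp⟩
    · rintro ⟨p, ⟨h1, h2⟩, rfl⟩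
      exact ⟨h1, by simpa using h2⟩
  rw [this]
  exact (isCompact_Icc.prod isCompact_Icc).image (by fun_prop)

/-- A weight that factors in the coordinates `(μ₁, θ)`, `θ = μ₂ + γ μ₁`, integrates to a product. -/
theorem setLIntegral_sheared_mul {I J : Set ℝ} (hI : MeasurableSet I) (hJ : MeasurableSet J)
    {f₁ f₂ : ℝ → ENNReal} (h₁ : Measurable f₁) (h₂ : Measurable f₂) :
    ∫⁻ μ in sheared γ I J, f₁ μ.1 * f₂ (μ.2 + γ * μ.1) = (∫⁻ x in I, f₁ x) * ∫⁻ θ in J, f₂ θ := by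
  have h1 := h₁.indicator hI
  have h2 := h₂.indicator hJ
  rw [← lintegral_indicator (measurableSet_sheared hI hJ), ← lintegral_indicator hI,
    ← lintegral_indicator hJ]
  have e : (sheared γ I J).indicator (fun μ : ℝ × ℝ => f₁ μ.1 * f₂ (μ.2 + γ * μ.1)) =
      fun μ => I.indicator f₁ μ.1 * J.indicator f₂ (μ.2 + γ * μ.1) := by
    ext μ
    by_cases hx : μ.1 ∈ I <;> by_cases hy : μ.2 + γ * μ.1 ∈ J <;> simp [sheared, indicator, hx, hy]
  rw [e, Measure.volume_eq_prod, lintegral_prod _ (by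
    refine Measurable.aemeasurable ?_
    exact (h1.comp measurable_fst).mul (h2.comp (by fun_prop)))]
  have : ∀ x : ℝ, ∫⁻ y, I.indicator f₁ x * J.indicator f₂ (y + γ * x) =
      I.indicator f₁ x * ∫⁻ θ, J.indicator f₂ θ := fun x => by
    rw [lintegral_const_mul _ (by exact h2.comp (measurable_add_const _)),
      lintegral_add_right_eq_self (fun y => J.indicator f₂ y) (γ * x)]
  simp only [this]
  rw [lintegral_mul_const _ h1]

theorem exists_prior_bounds {M : Set (ℝ × ℝ)} (hM : IsCompact M) {g : ℝ × ℝ → ℝ}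
    (hg : IsPriorDensity M g) : ∃ p q : ℝ, 0 < p ∧ 0 < q ∧ ∀ μ ∈ M, p ≤ g μ ∧ g μ ≤ q := by
  rcases M.eq_empty_or_nonempty with rfl | hne
  · exact ⟨1, 1, one_pos, one_pos, by simp⟩
  obtain ⟨x, hx, hmin⟩ := hM.exists_isMinOn hne hg.continuousOn
  obtain ⟨y, hy, hmax⟩ := hM.exists_isMaxOn hne hg.continuousOn
  exact ⟨g x, g y, hg.pos x hx, hg.pos y hy, fun μ hμ => ⟨hmin hμ, hmax hμ⟩⟩

variable {a b α β : ℝ} {g : ℝ × ℝ → ℝ} {h : ℕ → History} {t : ℕ} {f₁ f₂ : ℝ → ℝ} {p q : ℝ}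

theorem unnormalizedPosterior_le {I J : Set ℝ} (hI : MeasurableSet I) (hJ : MeasurableSet J)
    (hq0 : 0 ≤ q) (hq : ∀ μ ∈ sheared γ (Icc a b) (Icc α β), g μ ≤ q)
    (h₁ : Continuous f₁) (h₂ : Continuous f₂) (p₁ : ∀ x, 0 < f₁ x) (p₂ : ∀ x, 0 < f₂ x)
    (hL : ∀ μ : ℝ × ℝ, ∏ s ∈ Finset.range t, likelihood γ v μ (h s) = f₁ μ.1 * f₂ (μ.2 + γ * μ.1)) :
    unnormalizedPosterior γ v (sheared γ (Icc a b) (Icc α β)) g h t (sheared γ I J) ≤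
      ENNReal.ofReal q * ((∫⁻ x in Icc a b ∩ I, ENNReal.ofReal (f₁ x)) *
        ∫⁻ θ in Icc α β ∩ J, ENNReal.ofReal (f₂ θ)) := by
  have m₁ : Measurable fun x => ENNReal.ofReal (f₁ x) := h₁.measurable.ennreal_ofReal
  have m₂ : Measurable fun x => ENNReal.ofReal (f₂ x) := h₂.measurable.ennreal_ofReal
  have hset : sheared γ I J ∩ sheared γ (Icc a b) (Icc α β) =
      sheared γ (Icc a b ∩ I) (Icc α β ∩ J) := by
    ext μ; simp only [sheared, mem_inter_iff, mem_ofPred_eq]; tauto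
  have hI' := (measurableSet_Icc (a := a) (b := b)).inter hI
  have hJ' := (measurableSet_Icc (a := α) (b := β)).inter hJ
  rw [unnormalizedPosterior, withDensity_apply _ (measurableSet_sheared hI hJ),
    Measure.restrict_restrict (measurableSet_sheared hI hJ), hset,
    ← setLIntegral_sheared_mul (γ := γ) hI' hJ' m₁ m₂, ← lintegral_const_mul _ (by
      exact (m₁.comp measurable_fst).mul (m₂.comp (by fun_prop)))]
  refine setLIntegral_mono' (measurableSet_sheared hI' hJ') fun μ hμ => ?_
  rw [hL, ← ENNReal.ofReal_mul (p₁ _).le, ← ENNReal.ofReal_mul hq0]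
  exact ENNReal.ofReal_le_ofReal (mul_le_mul_of_nonneg_right (hq μ ⟨hμ.1.1, hμ.2.1⟩)
    (mul_pos (p₁ _) (p₂ _)).le)

theorem le_unnormalizedPosterior_univ
    (hp0 : 0 ≤ p) (hp : ∀ μ ∈ sheared γ (Icc a b) (Icc α β), p ≤ g μ)
    (h₁ : Continuous f₁) (h₂ : Continuous f₂) (p₁ : ∀ x, 0 < f₁ x) (p₂ : ∀ x, 0 < f₂ x)
    (hL : ∀ μ : ℝ × ℝ, ∏ s ∈ Finset.range t, likelihood γ v μ (h s) = f₁ μ.1 * f₂ (μ.2 + γ * μ.1)) :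
    ENNReal.ofReal p * ((∫⁻ x in Icc a b, ENNReal.ofReal (f₁ x)) *
        ∫⁻ θ in Icc α β, ENNReal.ofReal (f₂ θ)) ≤
      unnormalizedPosterior γ v (sheared γ (Icc a b) (Icc α β)) g h t univ := by
  have m₁ : Measurable fun x => ENNReal.ofReal (f₁ x) := h₁.measurable.ennreal_ofReal
  have m₂ : Measurable fun x => ENNReal.ofReal (f₂ x) := h₂.measurable.ennreal_ofReal
  rw [unnormalizedPosterior, withDensity_apply _ MeasurableSet.univ, Measure.restrict_univ,
    ← setLIntegral_sheared_mul (γ := γ) measurableSet_Icc measurableSet_Icc m₁ m₂,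
    ← lintegral_const_mul _ (by
      exact (m₁.comp measurable_fst).mul (m₂.comp (by fun_prop)))]
  refine setLIntegral_mono' (measurableSet_sheared measurableSet_Icc measurableSet_Icc)
    fun μ hμ => ?_
  rw [hL, ← ENNReal.ofReal_mul (p₁ _).le, ← ENNReal.ofReal_mul hp0]
  exact ENNReal.ofReal_le_ofReal (mul_le_mul_of_nonneg_right (hp μ hμ)
    (mul_pos (p₁ _) (p₂ _)).le)

theorem setLIntegral_Icc_ofReal_pos {f : ℝ → ℝ} (hf : Continuous f) (hpos : ∀ x, 0 < f x)
    (hab : a < b) : 0 < ∫⁻ x in Icc a b, ENNReal.ofReal (f x) := by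
  rw [setLIntegral_pos_iff hf.measurable.ennreal_ofReal]
  have : Function.support (fun x => ENNReal.ofReal (f x)) = univ := by
    ext x; simp [hpos x]
  rw [this, univ_inter, Real.volume_Icc]
  simpa using hab

theorem setLIntegral_Icc_ofReal_lt_top {f : ℝ → ℝ} (hf : Continuous f) (a b : ℝ) :
    ∫⁻ x in Icc a b, ENNReal.ofReal (f x) < ⊤ := by
  have h1 : IntegrableOn f (Icc a b) := hf.continuousOn.integrableOn_compact isCompact_Icc
  refine (lintegral_mono fun x => ?_).trans_lt h1.2
  exact Real.ofReal_le_enorm _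

theorem isProbabilityMeasure_posterior (hab : a < b) (hαβ : α < β)
    (hg : IsPriorDensity (sheared γ (Icc a b) (Icc α β)) g)
    (h₁ : Continuous f₁) (h₂ : Continuous f₂) (p₁ : ∀ x, 0 < f₁ x) (p₂ : ∀ x, 0 < f₂ x)
    (hL : ∀ μ : ℝ × ℝ, ∏ s ∈ Finset.range t, likelihood γ v μ (h s) = f₁ μ.1 * f₂ (μ.2 + γ * μ.1)) :
    IsProbabilityMeasure (posterior γ v (sheared γ (Icc a b) (Icc α β)) g h t) := by
  obtain ⟨p, q, hp0, hq0, hpq⟩ := exists_prior_bounds (isCompact_sheared γ a b α β) hg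
  have hlow := le_unnormalizedPosterior_univ (v := v) hp0.le (fun μ hμ => (hpq μ hμ).1)
    h₁ h₂ p₁ p₂ hL
  have hup := unnormalizedPosterior_le (v := v) (I := univ) (J := univ) MeasurableSet.univ
    MeasurableSet.univ hq0.le (fun μ hμ => (hpq μ hμ).2) h₁ h₂ p₁ p₂ hL
  have huniv : sheared γ univ univ = univ := by ext μ; simp [sheared]
  rw [huniv, inter_univ, inter_univ] at hup
  constructor
  rw [posterior, Measure.smul_apply, smul_eq_mul, ENNReal.inv_mul_cancel]
  · refine (hlow.trans_lt' ?_).ne'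
    exact ENNReal.mul_pos (ENNReal.ofReal_pos.2 hp0).ne' (ENNReal.mul_pos
      (setLIntegral_Icc_ofReal_pos h₁ p₁ hab).ne' (setLIntegral_Icc_ofReal_pos h₂ p₂ hαβ).ne').ne'
  · refine (hup.trans_lt ?_).ne
    exact ENNReal.mul_lt_top ENNReal.ofReal_lt_top (ENNReal.mul_lt_top
      (setLIntegral_Icc_ofReal_lt_top h₁ a b) (setLIntegral_Icc_ofReal_lt_top h₂ α β))

theorem posterior_compl_eq_zero (h : ℕ → History) (t : ℕ) :
    posterior γ v (sheared γ (Icc a b) (Icc α β)) g h t (sheared γ (Icc a b) (Icc α β))ᶜ = 0 := by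
  have hm := (measurableSet_sheared (γ := γ) (measurableSet_Icc (a := a) (b := b))
    (measurableSet_Icc (a := α) (b := β)))
  rw [posterior, Measure.smul_apply, unnormalizedPosterior, withDensity_apply _ hm.compl,
    Measure.restrict_restrict hm.compl, compl_inter_self]
  simp

/-- A comparison of the factored likelihood over a sheared rectangle with the likelihood over the
whole parallelogram bounds the posterior probability, up to the oscillation `q / p` of the prior. -/
theorem posterior_sheared_le {I J : Set ℝ} (hI : MeasurableSet I) (hJ : MeasurableSet J)
    (hp0 : 0 < p) (hq0 : 0 < q)
    (hpq : ∀ μ ∈ sheared γ (Icc a b) (Icc α β), p ≤ g μ ∧ g μ ≤ q)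
    (h₁ : Continuous f₁) (h₂ : Continuous f₂) (p₁ : ∀ x, 0 < f₁ x) (p₂ : ∀ x, 0 < f₂ x)
    (hL : ∀ μ : ℝ × ℝ, ∏ s ∈ Finset.range t, likelihood γ v μ (h s) = f₁ μ.1 * f₂ (μ.2 + γ * μ.1))
    {δ : ℝ} (hδ : 0 ≤ δ)
    (hle : (∫⁻ x in Icc a b ∩ I, ENNReal.ofReal (f₁ x)) *
        ∫⁻ θ in Icc α β ∩ J, ENNReal.ofReal (f₂ θ) ≤
      ENNReal.ofReal δ * ((∫⁻ x in Icc a b, ENNReal.ofReal (f₁ x)) *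
        ∫⁻ θ in Icc α β, ENNReal.ofReal (f₂ θ))) :
    posterior γ v (sheared γ (Icc a b) (Icc α β)) g h t (sheared γ I J) ≤
      ENNReal.ofReal (q / p * δ) := by
  have hlow := le_unnormalizedPosterior_univ (v := v) hp0.le (fun μ hμ => (hpq μ hμ).1)
    h₁ h₂ p₁ p₂ hL
  have hup := unnormalizedPosterior_le (v := v) hI hJ hq0.le (fun μ hμ => (hpq μ hμ).2)
    h₁ h₂ p₁ p₂ hL
  set U := unnormalizedPosterior γ v (sheared γ (Icc a b) (Icc α β)) g h t
  have h3 : U (sheared γ I J) ≤ ENNReal.ofReal (q / p * δ) * U univ := by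
    calc U (sheared γ I J) ≤ _ := hup
      _ ≤ ENNReal.ofReal q * (ENNReal.ofReal δ * ((∫⁻ x in Icc a b, ENNReal.ofReal (f₁ x)) *
        ∫⁻ θ in Icc α β, ENNReal.ofReal (f₂ θ))) := by gcongr
      _ = ENNReal.ofReal (q / p * δ) * (ENNReal.ofReal p *
          ((∫⁻ x in Icc a b, ENNReal.ofReal (f₁ x)) *
            ∫⁻ θ in Icc α β, ENNReal.ofReal (f₂ θ))) := by
          rw [← mul_assoc (ENNReal.ofReal q), ← mul_assoc (ENNReal.ofReal (q / p * δ)),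
            ← ENNReal.ofReal_mul hq0.le, ← ENNReal.ofReal_mul (by positivity)]
          congr 2
          field_simp
      _ ≤ _ := by gcongr
  rw [posterior, Measure.smul_apply, smul_eq_mul]
  calc (U univ)⁻¹ * U (sheared γ I J) ≤ (U univ)⁻¹ * (ENNReal.ofReal (q / p * δ) * U univ) := by
        gcongr
    _ = ENNReal.ofReal (q / p * δ) * ((U univ)⁻¹ * U univ) := by ring
    _ ≤ ENNReal.ofReal (q / p * δ) * 1 := by
        gcongr
        exact ENNReal.inv_mul_le_one _
    _ = _ := mul_one _

/-- If the likelihood is a product of quadratic exponentials in `μ₁` and in the intercept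
`θ = μ₂ + γ μ₁`, the posterior concentrates in either coordinate around the projection of the peak
of the likelihood as the corresponding precision grows. -/
theorem exists_posterior_concentration (hab : a < b) (hαβ : α < β)
    (hg : IsPriorDensity (sheared γ (Icc a b) (Icc α β)) g) (R : ℝ) {ε δ : ℝ} (hε : 0 < ε)
    (hδ : 0 < δ) : ∃ r₀ : ℝ, ∀ (h : ℕ → History) (t : ℕ) (k m x r y : ℝ), 0 < k →
      (∀ μ : ℝ × ℝ, ∏ s ∈ Finset.range t, likelihood γ v μ (h s) =
        k * Real.exp (-m * (μ.1 - x) ^ 2) * Real.exp (-r * (μ.2 + γ * μ.1 - y) ^ 2)) →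
      (r₀ ≤ m → |x| ≤ R → posterior γ v (sheared γ (Icc a b) (Icc α β)) g h t
        {μ | ε ≤ |μ.1 - clamp a b x|} ≤ ENNReal.ofReal δ) ∧
      (r₀ ≤ r → |y| ≤ R → posterior γ v (sheared γ (Icc a b) (Icc α β)) g h t
        {μ | ε ≤ |μ.2 + γ * μ.1 - clamp α β y|} ≤ ENNReal.ofReal δ) := by
  obtain ⟨p, q, hp0, hq0, hpq⟩ := exists_prior_bounds (isCompact_sheared γ a b α β) hg
  have hδ' : 0 < p / q * δ := by positivity
  have eδ : q / p * (p / q * δ) = δ := by field_simp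
  obtain ⟨r₁, hr₁⟩ := exists_concentration hab R hε hδ'
  obtain ⟨r₂, hr₂⟩ := exists_concentration hαβ R hε hδ'
  refine ⟨max r₁ r₂, fun h t k m x r y hk hL => ?_⟩
  have c₁ : Continuous fun z : ℝ => k * Real.exp (-m * (z - x) ^ 2) := by fun_prop
  have c₂ : Continuous fun z : ℝ => Real.exp (-r * (z - y) ^ 2) := by fun_prop
  have p₁ : ∀ z : ℝ, 0 < k * Real.exp (-m * (z - x) ^ 2) := fun z => by positivity
  have p₂ : ∀ z : ℝ, 0 < Real.exp (-r * (z - y) ^ 2) := fun z => by positivity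
  have hball : ∀ z : ℝ, MeasurableSet {θ : ℝ | ε ≤ |θ - z|} := fun z =>
    measurableSet_le measurable_const (by fun_prop)
  constructor
  · intro hm hx
    have e : {μ : ℝ × ℝ | ε ≤ |μ.1 - clamp a b x|} =
        sheared γ {z | ε ≤ |z - clamp a b x|} univ := by
      ext μ; simp [sheared]
    rw [e, ← eδ]
    refine posterior_sheared_le (hball _) MeasurableSet.univ hp0 hq0 hpq c₁ c₂ p₁ p₂ hL hδ'.le ?_
    rw [inter_univ, ← mul_assoc]
    gcongr
    simp only [ENNReal.ofReal_mul hk.le]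
    rw [lintegral_const_mul _ (by fun_prop), lintegral_const_mul _ (by fun_prop), mul_left_comm]
    gcongr
    exact hr₁ m ((le_max_left _ _).trans hm) x hx
  · intro hr hy
    have e : {μ : ℝ × ℝ | ε ≤ |μ.2 + γ * μ.1 - clamp α β y|} =
        sheared γ univ {z | ε ≤ |z - clamp α β y|} := by
      ext μ; simp [sheared]
    rw [e, ← eδ]
    refine posterior_sheared_le MeasurableSet.univ (hball _) hp0 hq0 hpq c₁ c₂ p₁ p₂ hL hδ'.le ?_
    rw [inter_univ, mul_left_comm]
    gcongr
    exact hr₂ r ((le_max_right _ _).trans hr) y hy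

end Posterior

/-! ### The likelihood of a censored sample -/

section Likelihood

variable {γ : ℝ} {v : ℝ≥0}

/-- The number of rounds before `t` in which the second draw is not censored. -/
noncomputable def uncensoredCount (c : ℕ → ℝ) (ω : SamplePath) (t : ℕ) : ℝ :=
  ∑ s ∈ Finset.range t, {x : ℝ × ℝ | x.1 ≤ c s}.indicator 1 (ω s)

/-- The sum of the observed values of `X₂ + γ X₁` before round `t`. -/
noncomputable def uncensoredSum (γ : ℝ) (c : ℕ → ℝ) (ω : SamplePath) (t : ℕ) : ℝ :=
  ∑ s ∈ Finset.range t, {x : ℝ × ℝ | x.1 ≤ c s}.indicator (fun x => x.2 + γ * x.1) (ω s)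

theorem gaussianPDFReal_eq_mul_exp (hv : 0 < v) (x : ℝ) :
    ∃ k : ℝ, 0 < k ∧ ∀ m,
      gaussianPDFReal m v x = k * Real.exp (-(m ^ 2 - 2 * m * x) / (2 * v)) := by
  have hv' : (0 : ℝ) < v := hv
  refine ⟨(√(2 * Real.pi * v))⁻¹ * Real.exp (-x ^ 2 / (2 * v)), by positivity, fun m => ?_⟩
  rw [gaussianPDFReal, mul_assoc _ (Real.exp _), ← Real.exp_add]
  congr 2
  field_simp
  ring

/-- As a function of the fundamentals, the likelihood of the histories is a Gaussian factor in `μ₁`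
times a Gaussian factor in the intercept `θ = μ₂ + γ μ₁`. -/
theorem exists_prod_likelihood_eq (hv : 0 < v) (c : ℕ → ℝ) (ω : SamplePath) (t : ℕ) :
    ∃ k : ℝ, 0 < k ∧ ∀ μ : ℝ × ℝ,
      ∏ s ∈ Finset.range t, likelihood γ v μ (history (c s) (ω s)) =
        k * Real.exp (-(t * μ.1 ^ 2 - 2 * μ.1 * ∑ s ∈ Finset.range t, (ω s).1) / (2 * v)) *
          Real.exp (-(uncensoredCount c ω t * (μ.2 + γ * μ.1) ^ 2 -
            2 * (μ.2 + γ * μ.1) * uncensoredSum γ c ω t) / (2 * v)) := by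
  have hv' : (0 : ℝ) < v := hv
  induction t with
  | zero => exact ⟨1, one_pos, fun μ => by simp [uncensoredCount, uncensoredSum]⟩
  | succ t ih =>
    obtain ⟨k, hk, hkμ⟩ := ih
    obtain ⟨k₁, hk₁, h₁⟩ := gaussianPDFReal_eq_mul_exp hv (ω t).1
    obtain ⟨k₂, hk₂, h₂⟩ := gaussianPDFReal_eq_mul_exp hv ((ω t).2 + γ * (ω t).1)
    have hN : uncensoredCount c ω (t + 1) = uncensoredCount c ω t +
        {x : ℝ × ℝ | x.1 ≤ c t}.indicator 1 (ω t) := Finset.sum_range_succ _ _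
    have hS : uncensoredSum γ c ω (t + 1) = uncensoredSum γ c ω t +
        {x : ℝ × ℝ | x.1 ≤ c t}.indicator (fun x => x.2 + γ * x.1) (ω t) :=
      Finset.sum_range_succ _ _
    by_cases hc : (ω t).1 ≤ c t
    · refine ⟨k * (k₁ * k₂), by positivity, fun μ => ?_⟩
      have e : gaussianPDFReal (μ.2 - γ * ((ω t).1 - μ.1)) v (ω t).2 =
          gaussianPDFReal (μ.2 + γ * μ.1) v ((ω t).2 + γ * (ω t).1) := by
        unfold gaussianPDFReal
        congr 3
        ring
      rw [Finset.prod_range_succ, hkμ, hN, hS, Finset.sum_range_succ]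
      have : likelihood γ v μ (history (c t) (ω t)) = gaussianPDFReal μ.1 v (ω t).1 *
          gaussianPDFReal (μ.2 - γ * ((ω t).1 - μ.1)) v (ω t).2 := by
        simp [history, hc, likelihood]
      rw [this, e, h₁, h₂, indicator_of_mem (by exact hc), indicator_of_mem (by exact hc)]
      have : ∀ A B C D : ℝ, k * Real.exp A * Real.exp B * (k₁ * Real.exp C * (k₂ * Real.exp D)) =
          k * (k₁ * k₂) * Real.exp (A + C) * Real.exp (B + D) := by
        intro A B C D
        rw [Real.exp_add, Real.exp_add]
        ring
      rw [this]
      congr 3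
      · push_cast
        ring
      · simp only [Pi.one_apply]
        ring
    · refine ⟨k * k₁, by positivity, fun μ => ?_⟩
      rw [Finset.prod_range_succ, hkμ, hN, hS, Finset.sum_range_succ]
      have : likelihood γ v μ (history (c t) (ω t)) = gaussianPDFReal μ.1 v (ω t).1 := by
        simp [history, hc, likelihood]
      rw [this, h₁, indicator_of_notMem (by exact hc), indicator_of_notMem (by exact hc), add_zero,
        add_zero]
      have : ∀ A B C : ℝ, k * Real.exp A * Real.exp B * (k₁ * Real.exp C) =
          k * k₁ * Real.exp (A + C) * Real.exp B := by
        intro A B C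
        rw [Real.exp_add]
        ring
      rw [this]
      congr 3
      push_cast
      ring

theorem exists_prod_likelihood_eq_sq (hv : 0 < v) (c : ℕ → ℝ) (ω : SamplePath) {t : ℕ} (ht : 0 < t)
    (hN : 0 < uncensoredCount c ω t) :
    ∃ k : ℝ, 0 < k ∧ ∀ μ : ℝ × ℝ,
      ∏ s ∈ Finset.range t, likelihood γ v μ (history (c s) (ω s)) =
        k * Real.exp (-(t / (2 * v)) * (μ.1 - (t : ℝ)⁻¹ * ∑ s ∈ Finset.range t, (ω s).1) ^ 2) *
          Real.exp (-(uncensoredCount c ω t / (2 * v)) *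
            (μ.2 + γ * μ.1 - uncensoredSum γ c ω t / uncensoredCount c ω t) ^ 2) := by
  have hv' : (0 : ℝ) < v := hv
  have ht' : (0 : ℝ) < t := by exact_mod_cast ht
  obtain ⟨k, hk, hkμ⟩ := exists_prod_likelihood_eq (γ := γ) hv c ω t
  set N := uncensoredCount c ω t
  set S := uncensoredSum γ c ω t
  set A := ∑ s ∈ Finset.range t, (ω s).1
  refine ⟨k * Real.exp (A ^ 2 / (t * (2 * v))) * Real.exp (S ^ 2 / (N * (2 * v))), by positivity,
    fun μ => ?_⟩
  rw [hkμ]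
  have : ∀ B C D E : ℝ, k * Real.exp B * Real.exp C * Real.exp D * Real.exp E =
      k * Real.exp (B + D) * Real.exp (C + E) := by
    intro B C D E
    rw [Real.exp_add, Real.exp_add]
    ring
  rw [this]
  congr 3
  · field_simp
    ring
  · field_simp
    ring

end Likelihood

/-! ### Optimal cutoffs under concentrated beliefs -/

section OptimalCutoff

variable {u₁ : ℝ → ℝ} {u₂ : ℝ → ℝ → ℝ} {γ : ℝ} {v : ℝ≥0}

/-- The expected gain, under `Ψ(μ; γ)`, from lowering the cutoff from `q` to `p`. -/
noncomputable def loweringGain (u₁ : ℝ → ℝ) (u₂ : ℝ → ℝ → ℝ) (γ : ℝ) (v : ℝ≥0) (p q : ℝ)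
    (μ : ℝ × ℝ) : ℝ :=
  ∫ x in Ioc p q, gaussianPDFReal μ.1 v x * stopGain u₁ u₂ γ v (μ.2 + γ * μ.1) x

theorem continuous_gaussianPDFReal (v : ℝ≥0) :
    Continuous fun p : ℝ × ℝ => gaussianPDFReal p.1 v p.2 := by
  unfold gaussianPDFReal
  fun_prop

/-- The absolute first moments `E|f Y|`, `Y ∼ N(m, σ²)`, of a monotone function are bounded for `m`
in a bounded interval. -/
theorem integral_abs_gaussianReal_le {f : ℝ → ℝ} (hmono : Monotone f)
    (hint : ∀ m, Integrable f (gaussianReal m v)) {m₀ m₁ m : ℝ} (h₀ : m₀ ≤ m) (h₁ : m ≤ m₁) :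
    ∫ y, |f y| ∂gaussianReal m v ≤
      ∫ y, |f y| ∂gaussianReal m₀ v + ∫ y, |f y| ∂gaussianReal m₁ v := by
  simp only [integral_gaussianReal_shift fun y => |f y|]
  have i := fun m => (integrable_gaussianReal_shift hint m).abs
  rw [← integral_add (i m₀) (i m₁)]
  exact integral_mono (i m) ((i m₀).add (i m₁)) fun z =>
    abs_le_of_monotone hmono (by linarith) (by linarith)

namespace RegularPayoffs

variable (h : RegularPayoffs u₁ u₂)
include h

theorem abs_snd_le (c x y : ℝ) : |u₂ x y| ≤ |u₂ c y| + |u₁ x - u₁ c| := by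
  have h1 : |u₂ x y - u₂ c y| ≤ |u₁ x - u₁ c| := by
    rcases lt_trichotomy c x with hx | rfl | hx
    · exact (h.abs_sub_lt c x y hx).le.trans (le_abs_self _)
    · simp
    · rw [abs_sub_comm, abs_sub_comm (u₁ x)]
      exact (h.abs_sub_lt x c y hx).le.trans (le_abs_self _)
  have := abs_sub_abs_le_abs_sub (u₂ x y) (u₂ c y)
  linarith

theorem integral_abs_sub_le (hγ : 0 < γ) (θ : ℝ) {p q x : ℝ} (hx : x ∈ Icc p q) :
    ∫ y, |u₂ x y - u₁ x| ∂gaussianReal (θ - γ * x) v ≤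
      ∫ y, |u₂ p y| ∂gaussianReal (θ - γ * q) v + ∫ y, |u₂ p y| ∂gaussianReal (θ - γ * p) v +
        (u₁ q - u₁ p + (|u₁ p| + |u₁ q|)) := by
  have hp1 : u₁ p ≤ u₁ x := h.strictMono_fst.monotone hx.1
  have hq1 : u₁ x ≤ u₁ q := h.strictMono_fst.monotone hx.2
  have hu := abs_le_of_monotone h.strictMono_fst.monotone hx.1 hx.2
  have i0 := (h.integrable p (θ - γ * x) v).abs
  have i1 : Integrable (fun y => |u₂ p y| + (u₁ q - u₁ p + (|u₁ p| + |u₁ q|)))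
      (gaussianReal (θ - γ * x) v) := i0.add (integrable_const _)
  calc ∫ y, |u₂ x y - u₁ x| ∂gaussianReal (θ - γ * x) v
      ≤ ∫ y, (|u₂ p y| + (u₁ q - u₁ p + (|u₁ p| + |u₁ q|))) ∂gaussianReal (θ - γ * x) v := by
        refine integral_mono ((h.integrable x _ v).sub (integrable_const _)).abs i1 fun y => ?_
        have h1 := h.abs_snd_le p x y
        rw [abs_of_nonneg (sub_nonneg.2 hp1)] at h1
        have h2 := abs_sub (u₂ x y) (u₁ x)
        simp only
        linarith
    _ = ∫ y, |u₂ p y| ∂gaussianReal (θ - γ * x) v + (u₁ q - u₁ p + (|u₁ p| + |u₁ q|)) := by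
        rw [integral_add i0 (integrable_const _)]; simp
    _ ≤ _ := by
        refine add_le_add ?_ le_rfl
        exact integral_abs_gaussianReal_le (h.strictMono_snd p).monotone
          (fun m => h.integrable p m v) (by linarith [mul_le_mul_of_nonneg_left hx.2 hγ.le])
          (by linarith [mul_le_mul_of_nonneg_left hx.1 hγ.le])

theorem integrable_model_gain (hγ : 0 < γ) (hv : 0 < v) (μ : ℝ × ℝ) (p q : ℝ) :
    Integrable fun x : ℝ × ℝ =>
      gaussianPDFReal μ.1 v x.1 * gaussianPDFReal (μ.2 - γ * (x.1 - μ.1)) v x.2 *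
        (Ioc p q ×ˢ univ).indicator (fun x => u₂ x.1 x.2 - u₁ x.1) x := by
  have hu₁ := h.continuous_fst
  have hu₂ := h.continuous_snd
  have hmeas : Measurable fun x : ℝ × ℝ =>
      gaussianPDFReal μ.1 v x.1 * gaussianPDFReal (μ.2 - γ * (x.1 - μ.1)) v x.2 *
        (Ioc p q ×ˢ univ).indicator (fun x => u₂ x.1 x.2 - u₁ x.1) x := by
    refine Measurable.mul (Continuous.measurable ?_) (Measurable.indicator
      (Continuous.measurable (by fun_prop)) (measurableSet_Ioc.prod MeasurableSet.univ))
    exact ((continuous_gaussianPDFReal v).comp (by fun_prop : Continuous fun x : ℝ × ℝ =>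
      (μ.1, x.1))).mul ((continuous_gaussianPDFReal v).comp (by fun_prop : Continuous
        fun x : ℝ × ℝ => (μ.2 - γ * (x.1 - μ.1), x.2)))
  have hmean : ∀ x, μ.2 - γ * (x - μ.1) = μ.2 + γ * μ.1 - γ * x := fun x => by ring
  have hslice : ∀ x y, gaussianPDFReal μ.1 v x * gaussianPDFReal (μ.2 - γ * (x - μ.1)) v y *
        (Ioc p q ×ˢ univ).indicator (fun x : ℝ × ℝ => u₂ x.1 x.2 - u₁ x.1) (x, y) =
      (Ioc p q).indicator (fun x => gaussianPDFReal μ.1 v x) x *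
        (gaussianPDFReal (μ.2 + γ * μ.1 - γ * x) v y * (u₂ x y - u₁ x)) := by
    intro x y
    rw [hmean]
    by_cases hx : x ∈ Ioc p q
    · simp only [indicator, mem_prod, hx, mem_univ, and_self, if_true]
      ring
    · simp only [indicator, mem_prod, hx, false_and, if_false, mul_zero, zero_mul]
  rw [Measure.volume_eq_prod, integrable_prod_iff hmeas.aestronglyMeasurable]
  constructor
  · refine Eventually.of_forall fun x => ?_
    simp only [hslice]
    exact ((integrable_gaussianReal_iff hv _ _).1
      ((h.integrable x _ v).sub (integrable_const _))).const_mul _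
  · set K := ∫ y, |u₂ p y| ∂gaussianReal (μ.2 + γ * μ.1 - γ * q) v +
      ∫ y, |u₂ p y| ∂gaussianReal (μ.2 + γ * μ.1 - γ * p) v + (u₁ q - u₁ p + (|u₁ p| + |u₁ q|))
    have hdom : Integrable fun x => (Ioc p q).indicator (fun x => gaussianPDFReal μ.1 v x) x * K :=
      ((integrable_gaussianPDFReal μ.1 v).indicator measurableSet_Ioc).mul_const K
    refine hdom.mono' hmeas.stronglyMeasurable.norm.integral_prod_right'.aestronglyMeasurable
      (Eventually.of_forall fun x => ?_)
    have hnn : 0 ≤ (Ioc p q).indicator (fun x => gaussianPDFReal μ.1 v x) x :=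
      indicator_nonneg (fun x _ => gaussianPDFReal_nonneg _ _ _) x
    rw [Real.norm_of_nonneg (integral_nonneg fun _ => norm_nonneg _)]
    simp only [hslice, norm_mul, Real.norm_of_nonneg hnn,
      Real.norm_of_nonneg (gaussianPDFReal_nonneg _ _ _)]
    rw [integral_const_mul]
    by_cases hx : x ∈ Ioc p q
    · refine mul_le_mul_of_nonneg_left ?_ hnn
      have := h.integral_abs_sub_le (v := v) hγ (μ.2 + γ * μ.1) (Ioc_subset_Icc_self hx)
      rwa [integral_gaussianReal_eq_integral_smul hv.ne'] at this
    · simp [hx]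

theorem integral_payoff_sub (hγ : 0 < γ) (hv : 0 < v) (μ : ℝ × ℝ) {p q : ℝ} (hpq : p ≤ q) :
    ∫ x, (payoff u₁ u₂ q x - payoff u₁ u₂ p x) ∂subjectiveModel γ v μ =
      -loweringGain u₁ u₂ γ v p q μ := by
  have hpay : ∀ x : ℝ × ℝ, payoff u₁ u₂ q x - payoff u₁ u₂ p x =
      (Ioc p q ×ˢ univ).indicator (fun x => u₂ x.1 x.2 - u₁ x.1) x := by
    intro x
    unfold payoff
    by_cases h1 : x.1 ≤ p
    · simp [indicator, h1, h1.trans hpq]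
    · by_cases h2 : x.1 ≤ q
      · simp [indicator, h1, h2, not_le.1 h1]
      · simp [indicator, h1, h2]
  have hm : Measurable fun x : ℝ × ℝ =>
      gaussianPDF μ.1 v x.1 * gaussianPDF (μ.2 - γ * (x.1 - μ.1)) v x.2 := by
    exact (Continuous.measurable ((continuous_gaussianPDFReal v).comp
      (by fun_prop : Continuous fun x : ℝ × ℝ => (μ.1, x.1)))).ennreal_ofReal.mul
      (Continuous.measurable ((continuous_gaussianPDFReal v).comp (by fun_prop : Continuous
        fun x : ℝ × ℝ => (μ.2 - γ * (x.1 - μ.1), x.2)))).ennreal_ofReal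
  simp only [hpay]
  rw [subjectiveModel, integral_withDensity_eq_integral_toReal_smul hm
    (Eventually.of_forall fun x => ENNReal.mul_lt_top gaussianPDF_lt_top gaussianPDF_lt_top)]
  simp only [ENNReal.toReal_mul, toReal_gaussianPDF, smul_eq_mul]
  have hi := h.integrable_model_gain hγ hv μ p q
  rw [Measure.volume_eq_prod] at hi ⊢
  rw [integral_prod _ hi, loweringGain, ← integral_neg, ← integral_indicator measurableSet_Ioc]
  congr 1 with x
  by_cases hx : x ∈ Ioc p q
  · have e : μ.2 - γ * (x - μ.1) = μ.2 + γ * μ.1 - γ * x := by ring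
    simp only [indicator, mem_prod, hx, mem_univ, and_self, if_true, mul_assoc]
    rw [integral_const_mul, ← integral_congr_ae (Eventually.of_forall fun y => smul_eq_mul _ _),
      ← integral_gaussianReal_eq_integral_smul hv.ne', e,
      integral_sub (h.integrable x _ v) (integrable_const _), stopGain, expectedSecond]
    simp only [integral_const, probReal_univ, one_smul]
    ring
  · simp [indicator, hx]

theorem integral_loweringGain_nonpos (hγ : 0 < γ) (hv : 0 < v) {ν : Measure (ℝ × ℝ)} {c c' : ℝ}
    (hc : IsOptimalCutoff u₁ u₂ γ v ν c) (hlt : c' ≤ c) :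
    ∫ μ, loweringGain u₁ u₂ γ v c' c μ ∂ν ≤ 0 := by
  have := hc c'
  simp only [h.integral_payoff_sub hγ hv _ hlt] at this
  rw [integral_neg] at this
  linarith

theorem integral_loweringGain_nonneg (hγ : 0 < γ) (hv : 0 < v) {ν : Measure (ℝ × ℝ)} {c c' : ℝ}
    (hc : IsOptimalCutoff u₁ u₂ γ v ν c) (hlt : c ≤ c') :
    0 ≤ ∫ μ, loweringGain u₁ u₂ γ v c c' μ ∂ν := by
  have := hc c'
  have e : ∀ μ, ∫ x, (payoff u₁ u₂ c x - payoff u₁ u₂ c' x) ∂subjectiveModel γ v μ =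
      loweringGain u₁ u₂ γ v c c' μ := fun μ => by
    rw [← neg_neg (loweringGain u₁ u₂ γ v c c' μ), ← h.integral_payoff_sub hγ hv _ hlt,
      ← integral_neg]
    simp
  simpa only [e] using this

theorem integrable_loweringGain_integrand (μ : ℝ × ℝ) (p q : ℝ) :
    IntegrableOn (fun x => gaussianPDFReal μ.1 v x * stopGain u₁ u₂ γ v (μ.2 + γ * μ.1) x)
      (Ioc p q) := by
  have h1 : Continuous fun x => gaussianPDFReal μ.1 v x :=
    (continuous_gaussianPDFReal v).comp (by fun_prop : Continuous fun x : ℝ => (μ.1, x))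
  have h2 : Continuous (stopGain u₁ u₂ γ v (μ.2 + γ * μ.1)) :=
    (h.continuous_stopGain (γ := γ) (v := v)).comp
      (by fun_prop : Continuous fun x : ℝ => (μ.2 + γ * μ.1, x))
  exact ((h1.mul h2).continuousOn.integrableOn_compact isCompact_Icc).mono_set Ioc_subset_Icc_self

theorem measurable_loweringGain (p q : ℝ) : Measurable (loweringGain u₁ u₂ γ v p q) := by
  have h1 : Continuous fun z : (ℝ × ℝ) × ℝ => gaussianPDFReal z.1.1 v z.2 :=
    (continuous_gaussianPDFReal v).comp (by fun_prop : Continuous fun z : (ℝ × ℝ) × ℝ =>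
      (z.1.1, z.2))
  have h2 : Continuous fun z : (ℝ × ℝ) × ℝ => stopGain u₁ u₂ γ v (z.1.2 + γ * z.1.1) z.2 :=
    (h.continuous_stopGain (γ := γ) (v := v)).comp
      (by fun_prop : Continuous fun z : (ℝ × ℝ) × ℝ => (z.1.2 + γ * z.1.1, z.2))
  exact (h1.mul h2).stronglyMeasurable.integral_prod_right'.measurable

theorem mul_window_le_loweringGain (hγ : 0 < γ) {μ : ℝ × ℝ} {θ p q : ℝ}
    (hθ : μ.2 + γ * μ.1 ≤ θ) :
    stopGain u₁ u₂ γ v θ p * ∫ x in Ioc p q, gaussianPDFReal μ.1 v x ≤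
      loweringGain u₁ u₂ γ v p q μ := by
  rw [← integral_const_mul]
  refine setIntegral_mono_on ((integrable_gaussianPDFReal _ _).const_mul _).integrableOn
    (h.integrable_loweringGain_integrand μ p q) measurableSet_Ioc fun x hx => ?_
  rw [mul_comm]
  refine mul_le_mul_of_nonneg_left ?_ (gaussianPDFReal_nonneg _ _ _)
  exact ((h.strictMono_stopGain hγ.le θ).monotone hx.1.le).trans
    ((h.strictAnti_stopGain x).antitone hθ)

theorem loweringGain_le_mul_window (hγ : 0 < γ) {μ : ℝ × ℝ} {θ p q : ℝ}
    (hθ : θ ≤ μ.2 + γ * μ.1) :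
    loweringGain u₁ u₂ γ v p q μ ≤
      stopGain u₁ u₂ γ v θ q * ∫ x in Ioc p q, gaussianPDFReal μ.1 v x := by
  rw [← integral_const_mul]
  refine setIntegral_mono_on (h.integrable_loweringGain_integrand μ p q)
    ((integrable_gaussianPDFReal _ _).const_mul _).integrableOn measurableSet_Ioc fun x hx => ?_
  rw [mul_comm (stopGain _ _ _ _ _ _)]
  refine mul_le_mul_of_nonneg_left ?_ (gaussianPDFReal_nonneg _ _ _)
  exact ((h.strictAnti_stopGain x).antitone hθ).trans
    ((h.strictMono_stopGain hγ.le θ).monotone hx.2)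

end RegularPayoffs

theorem window_nonneg (m p q : ℝ) : 0 ≤ ∫ x in Ioc p q, gaussianPDFReal m v x :=
  integral_nonneg fun _ => gaussianPDFReal_nonneg _ _ _

theorem window_le_one (hv : 0 < v) (m p q : ℝ) : ∫ x in Ioc p q, gaussianPDFReal m v x ≤ 1 := by
  rw [← integral_gaussianPDFReal_eq_one m hv.ne']
  exact setIntegral_le_integral (integrable_gaussianPDFReal m v)
    (Eventually.of_forall fun _ => gaussianPDFReal_nonneg _ _ _)

theorem exists_window_lower_bound (hv : 0 < v) {a b p q : ℝ} (hab : a ≤ b) (hpq : p < q) :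
    ∃ w, 0 < w ∧ ∀ m ∈ Icc a b, w ≤ ∫ x in Ioc p q, gaussianPDFReal m v x := by
  obtain ⟨z, hz, hmin⟩ := (isCompact_Icc.prod isCompact_Icc).exists_isMinOn
    (⟨(a, p), ⟨le_rfl, hab⟩, ⟨le_rfl, hpq.le⟩⟩ : (Icc a b ×ˢ Icc p q).Nonempty)
    (continuous_gaussianPDFReal v).continuousOn
  have hz0 := gaussianPDFReal_pos z.1 v z.2 hv.ne'
  refine ⟨(q - p) * gaussianPDFReal z.1 v z.2, mul_pos (sub_pos.2 hpq) hz0, fun m hm => ?_⟩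
  have h1 : ∫ _ in Ioc p q, gaussianPDFReal z.1 v z.2 = (q - p) * gaussianPDFReal z.1 v z.2 := by
    simp [hpq.le]
  rw [← h1]
  exact setIntegral_mono_on (by simp) (integrable_gaussianPDFReal m v).integrableOn
    measurableSet_Ioc fun x hx => hmin (show (m, x) ∈ _ from ⟨hm, Ioc_subset_Icc_self hx⟩)

theorem window_mono (m : ℝ) {p q p' q' : ℝ} (hp : p' ≤ p) (hq : q ≤ q') :
    ∫ x in Ioc p q, gaussianPDFReal m v x ≤ ∫ x in Ioc p' q', gaussianPDFReal m v x :=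
  setIntegral_mono_set (integrable_gaussianPDFReal m v).integrableOn
    (Eventually.of_forall fun _ => gaussianPDFReal_nonneg _ _ _)
    (Ioc_subset_Ioc hp hq).eventuallyLE

theorem integral_pos_of_large_probability {ν : Measure (ℝ × ℝ)} [IsProbabilityMeasure ν]
    {f : ℝ × ℝ → ℝ} (hf : Integrable f ν) {S : Set (ℝ × ℝ)} (hS : MeasurableSet S) {w K : ℝ}
    (hle : ∀ᵐ μ ∂ν, w - S.indicator (fun _ => w + K) μ ≤ f μ)
    (hsmall : (w + K) * ν.real S < w) : 0 < ∫ μ, f μ ∂ν := by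
  have i1 : Integrable (S.indicator fun _ : ℝ × ℝ => w + K) ν :=
    (integrable_const _).indicator hS
  have := integral_mono_ae ((integrable_const w).sub i1) hf hle
  simp only [Pi.sub_apply] at this
  rw [integral_sub (integrable_const _) i1, integral_indicator_const _ hS] at this
  simp only [integral_const, probReal_univ, smul_eq_mul] at this
  linarith

namespace RegularPayoffs

variable (h : RegularPayoffs u₁ u₂)
include h

theorem integrable_loweringGain (hγ : 0 < γ) (hv : 0 < v) {a b α β : ℝ} {ν : Measure (ℝ × ℝ)}
    [IsProbabilityMeasure ν] (hν : ν (sheared γ (Icc a b) (Icc α β))ᶜ = 0) (p q : ℝ) :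
    Integrable (loweringGain u₁ u₂ γ v p q) ν := by
  refine Integrable.of_bound (h.measurable_loweringGain p q).aestronglyMeasurable
    (|stopGain u₁ u₂ γ v β p| + |stopGain u₁ u₂ γ v α q|) ?_
  have : ∀ᵐ μ ∂ν, μ ∈ sheared γ (Icc a b) (Icc α β) := by
    rw [ae_iff]; exact hν
  filter_upwards [this] with μ hμ
  have h0 := window_nonneg (v := v) μ.1 p q
  have h1 := window_le_one hv μ.1 p q
  have h2 := h.mul_window_le_loweringGain (v := v) (p := p) (q := q) hγ hμ.2.2
  have h3 := h.loweringGain_le_mul_window (v := v) (p := p) (q := q) hγ hμ.2.1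
  have key : ∀ s : ℝ, |s * ∫ x in Ioc p q, gaussianPDFReal μ.1 v x| ≤ |s| := fun s => by
    rw [abs_mul, abs_of_nonneg h0]
    exact mul_le_of_le_one_right (abs_nonneg s) h1
  rw [Real.norm_eq_abs, abs_le]
  constructor
  · have := neg_abs_le (stopGain u₁ u₂ γ v β p * ∫ x in Ioc p q, gaussianPDFReal μ.1 v x)
    linarith [key (stopGain u₁ u₂ γ v β p), abs_nonneg (stopGain u₁ u₂ γ v α q)]
  · have := le_abs_self (stopGain u₁ u₂ γ v α q * ∫ x in Ioc p q, gaussianPDFReal μ.1 v x)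
    linarith [key (stopGain u₁ u₂ γ v α q), abs_nonneg (stopGain u₁ u₂ γ v β p)]

/-- An agent who is nearly certain that the intercept is at most `τ` does not use a cutoff much
above the one that is optimal for `τ`. -/
theorem exists_le_of_isOptimalCutoff (hγ : 0 < γ) (hv : 0 < v) {a b α β : ℝ} (hab : a ≤ b) (τ : ℝ)
    {η : ℝ} (hη : 0 < η) : ∃ δ > 0, ∀ (ν : Measure (ℝ × ℝ)) [IsProbabilityMeasure ν],
      ν (sheared γ (Icc a b) (Icc α β))ᶜ = 0 → ν.real {μ | τ < μ.2 + γ * μ.1} ≤ δ →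
      ∀ c, IsOptimalCutoff u₁ u₂ γ v ν c → c ≤ h.indifference hγ v τ + η := by
  set p := h.indifference hγ v τ + η / 2 with hp
  obtain ⟨w, hw0, hw⟩ := exists_window_lower_bound hv hab (show p < p + η / 2 by linarith)
  have hκ : 0 < stopGain u₁ u₂ γ v τ p := by
    rw [← h.stopGain_indifference hγ τ]
    exact h.strictMono_stopGain hγ.le τ (by linarith)
  set κ := stopGain u₁ u₂ γ v τ p
  set K := |stopGain u₁ u₂ γ v β p|
  have hκw : 0 < κ * w := mul_pos hκ hw0
  have hK : 0 ≤ K := abs_nonneg _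
  refine ⟨κ * w / (2 * (κ * w + K)), by positivity, fun ν _ hν hδ c hc => ?_⟩
  by_contra! hlt
  have hS : MeasurableSet {μ : ℝ × ℝ | τ < μ.2 + γ * μ.1} :=
    measurableSet_lt measurable_const (by fun_prop)
  refine absurd (h.integral_loweringGain_nonpos hγ hv hc (show p ≤ c by linarith)) (not_le.2 ?_)
  refine integral_pos_of_large_probability (h.integrable_loweringGain hγ hv hν p c) hS
    (w := κ * w) (K := K) ?_ ?_
  · have : ∀ᵐ μ ∂ν, μ ∈ sheared γ (Icc a b) (Icc α β) := by
      rw [ae_iff]; exact hν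
    filter_upwards [this] with μ hμ
    by_cases hμS : τ < μ.2 + γ * μ.1
    · rw [indicator_of_mem (by exact hμS)]
      refine (h.mul_window_le_loweringGain hγ hμ.2.2).trans' ?_
      have h1 : -K ≤ stopGain u₁ u₂ γ v β p := neg_abs_le _
      have h2 := mul_le_mul_of_nonneg_right h1 (window_nonneg (v := v) μ.1 p c)
      have h3 := mul_le_mul_of_nonneg_left (window_le_one hv μ.1 p c) hK
      linarith
    · rw [indicator_of_notMem (by exact hμS), sub_zero]
      refine (h.mul_window_le_loweringGain hγ (not_lt.1 hμS)).trans' ?_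
      exact mul_le_mul_of_nonneg_left ((hw _ hμ.1).trans
        (window_mono _ le_rfl (by linarith))) hκ.le
  · have := mul_le_mul_of_nonneg_left hδ (show 0 ≤ κ * w + K by positivity)
    refine this.trans_lt ?_
    rw [mul_div_assoc', div_lt_iff₀ (by positivity)]
    nlinarith

/-- An agent who is nearly certain that the intercept is at least `τ` does not use a cutoff much
below the one that is optimal for `τ`. -/
theorem exists_ge_of_isOptimalCutoff (hγ : 0 < γ) (hv : 0 < v) {a b α β : ℝ} (hab : a ≤ b) (τ : ℝ)
    {η : ℝ} (hη : 0 < η) : ∃ δ > 0, ∀ (ν : Measure (ℝ × ℝ)) [IsProbabilityMeasure ν],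
      ν (sheared γ (Icc a b) (Icc α β))ᶜ = 0 → ν.real {μ | μ.2 + γ * μ.1 < τ} ≤ δ →
      ∀ c, IsOptimalCutoff u₁ u₂ γ v ν c → h.indifference hγ v τ - η ≤ c := by
  set q := h.indifference hγ v τ - η / 2 with hq
  obtain ⟨w, hw0, hw⟩ := exists_window_lower_bound hv hab (show q - η / 2 < q by linarith)
  have hκ : 0 < -stopGain u₁ u₂ γ v τ q := by
    rw [neg_pos, ← h.stopGain_indifference hγ τ]
    exact h.strictMono_stopGain hγ.le τ (by linarith)
  set κ := -stopGain u₁ u₂ γ v τ q with hκdef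
  set K := |stopGain u₁ u₂ γ v α q|
  have hκw : 0 < κ * w := mul_pos hκ hw0
  have hK : 0 ≤ K := abs_nonneg _
  refine ⟨κ * w / (2 * (κ * w + K)), by positivity, fun ν _ hν hδ c hc => ?_⟩
  by_contra! hlt
  have hS : MeasurableSet {μ : ℝ × ℝ | μ.2 + γ * μ.1 < τ} :=
    measurableSet_lt (by fun_prop) measurable_const
  refine absurd (h.integral_loweringGain_nonneg hγ hv hc (show c ≤ q by linarith)) (not_le.2 ?_)
  rw [← neg_pos, ← integral_neg]
  refine integral_pos_of_large_probability (h.integrable_loweringGain hγ hv hν c q).neg hS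
    (w := κ * w) (K := K) ?_ ?_
  · have : ∀ᵐ μ ∂ν, μ ∈ sheared γ (Icc a b) (Icc α β) := by
      rw [ae_iff]; exact hν
    filter_upwards [this] with μ hμ
    rw [le_neg]
    by_cases hμS : μ.2 + γ * μ.1 < τ
    · rw [indicator_of_mem (by exact hμS)]
      refine (h.loweringGain_le_mul_window hγ hμ.2.1).trans ?_
      have h1 : stopGain u₁ u₂ γ v α q ≤ K := le_abs_self _
      have h2 := mul_le_mul_of_nonneg_right h1 (window_nonneg (v := v) μ.1 c q)
      have h3 := mul_le_mul_of_nonneg_left (window_le_one hv μ.1 c q) hK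
      linarith
    · rw [indicator_of_notMem (by exact hμS), sub_zero]
      refine (h.loweringGain_le_mul_window hγ (not_lt.1 hμS)).trans ?_
      have := mul_le_mul_of_nonneg_left ((hw _ hμ.1).trans
        (window_mono (v := v) μ.1 (show c ≤ q - η / 2 by linarith) le_rfl)) hκ.le
      linarith
  · have := mul_le_mul_of_nonneg_left hδ (show 0 ≤ κ * w + K by positivity)
    refine this.trans_lt ?_
    rw [mul_div_assoc', div_lt_iff₀ (by positivity)]
    nlinarith

end RegularPayoffs

end OptimalCutoff

/-! ### Deterministic asymptotics -/

/-- An asymptotic bound that improves by the factor `q < 1` forces convergence to zero. -/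
theorem tendsto_zero_of_contraction {z : ℕ → ℝ} {q L₀ : ℝ} (hz : ∀ t, 0 ≤ z t) (hq0 : 0 ≤ q)
    (hq1 : q < 1) (h₀ : ∀ᶠ t in atTop, z t ≤ L₀)
    (hstep : ∀ L, 0 ≤ L → (∀ᶠ t in atTop, z t ≤ L) → ∀ ε > 0, ∀ᶠ t in atTop, z t ≤ q * L + ε) :
    Tendsto z atTop (𝓝 0) := by
  set r := (1 + q) / 2 with hr
  set L := max L₀ 1
  have hL : 0 < L := lt_max_of_lt_right one_pos
  have hr0 : 0 < r := by linarith
  have hiter : ∀ n : ℕ, ∀ᶠ t in atTop, z t ≤ r ^ n * L := by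
    intro n
    induction n with
    | zero => 
      filter_upwards [h₀] with t ht
      rw [pow_zero, one_mul]
      exact ht.trans (le_max_left _ _)
    | succ n ih =>
      have hp : 0 < r ^ n * L := by positivity
      filter_upwards [hstep _ hp.le ih ((1 - q) / 2 * (r ^ n * L))
        (mul_pos (by linarith) hp)] with t ht
      refine ht.trans_eq ?_
      rw [pow_succ, hr]
      ring
  have hlim : Tendsto (fun n : ℕ => r ^ n * L) atTop (𝓝 0) := by
    simpa using (tendsto_pow_atTop_nhds_zero_of_lt_one hr0.le (by linarith)).mul_const L
  refine tendsto_order.2 ⟨fun a ha => Eventually.of_forall fun t => ha.trans_le (hz t),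
    fun a ha => ?_⟩
  obtain ⟨n, hn⟩ := (hlim.eventually_lt_const ha).exists
  filter_upwards [hiter n] with t ht using ht.trans_lt hn

/-- If `N` and `S - θ N` are asymptotically the sums of the weights `w` and of terms of size at most
`κ w`, then `S / N` is asymptotically within `κ` of `θ`. -/
theorem eventually_abs_ratio_sub_le {N S w d : ℕ → ℝ} {θ κ φ : ℝ} (hκ : 0 ≤ κ) (hφ : 0 < φ)
    (hw : ∀ s, 0 ≤ w s)
    (hN : Tendsto (fun t : ℕ => (t : ℝ)⁻¹ * (N t - ∑ s ∈ Finset.range t, w s)) atTop (𝓝 0))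
    (hS : Tendsto (fun t : ℕ => (t : ℝ)⁻¹ * (S t - θ * N t - ∑ s ∈ Finset.range t, d s)) atTop
      (𝓝 0))
    (hd : ∀ᶠ s in atTop, |d s| ≤ κ * w s) (hNφ : ∀ᶠ t : ℕ in atTop, φ * t ≤ N t) {ε : ℝ}
    (hε : 0 < ε) : ∀ᶠ t in atTop, |S t / N t - θ| ≤ κ + ε := by
  obtain ⟨s₀, hs₀⟩ := eventually_atTop.1 hd
  set K := ∑ s ∈ Finset.range s₀, |d s|
  have hsum : ∀ t ≥ s₀, |∑ s ∈ Finset.range t, d s| ≤ K + κ * ∑ s ∈ Finset.range t, w s := by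
    intro t ht
    refine (Finset.abs_sum_le_sum_abs _ _).trans ?_
    rw [← Finset.sum_range_add_sum_Ico _ ht]
    refine add_le_add le_rfl ?_
    calc ∑ s ∈ Finset.Ico s₀ t, |d s| ≤ ∑ s ∈ Finset.Ico s₀ t, κ * w s :=
          Finset.sum_le_sum fun s hs => hs₀ s (Finset.mem_Ico.1 hs).1
      _ ≤ ∑ s ∈ Finset.range t, κ * w s := by
          rw [← Finset.sum_range_add_sum_Ico _ ht]
          exact le_add_of_nonneg_left (Finset.sum_nonneg fun s _ => mul_nonneg hκ (hw s))
      _ = _ := (Finset.mul_sum _ _ _).symm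
  have herr : Tendsto (fun t : ℕ => |(t : ℝ)⁻¹ * (S t - θ * N t - ∑ s ∈ Finset.range t, d s)| +
      (t : ℝ)⁻¹ * K + κ * |(t : ℝ)⁻¹ * (N t - ∑ s ∈ Finset.range t, w s)|) atTop (𝓝 0) := by
    have := (hS.abs.add ((tendsto_natCast_atTop_atTop (R := ℝ)).inv_tendsto_atTop.mul_const K)).add
      (hN.abs.const_mul κ)
    simpa using this
  filter_upwards [eventually_ge_atTop s₀, eventually_gt_atTop 0, hNφ,
    herr.eventually_lt_const (show 0 < ε * φ by positivity)] with t ht ht0 htN hte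
  have ht' : (0 : ℝ) < t := by exact_mod_cast ht0
  have hN0 : 0 < N t := (mul_pos hφ ht').trans_le htN
  have e : S t / N t - θ = (S t - θ * N t) / N t := by field_simp
  rw [e, abs_div, abs_of_pos hN0, div_le_iff₀ hN0]
  rw [abs_mul, abs_mul, abs_of_pos (inv_pos.2 ht')] at hte
  have h1 : |S t - θ * N t - ∑ s ∈ Finset.range t, d s| + K +
      κ * |N t - ∑ s ∈ Finset.range t, w s| ≤ ε * φ * t := by
    have h2 := mul_le_mul_of_nonneg_right hte.le ht'.le
    refine h2.trans_eq' ?_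
    field_simp
  have h3 : |S t - θ * N t| ≤ |S t - θ * N t - ∑ s ∈ Finset.range t, d s| +
      |∑ s ∈ Finset.range t, d s| := by
    have := abs_add_le (S t - θ * N t - ∑ s ∈ Finset.range t, d s) (∑ s ∈ Finset.range t, d s)
    rwa [sub_add_cancel] at this
  have h4 := hsum t ht
  have h5 := mul_le_mul_of_nonneg_left
    (neg_abs_le (N t - ∑ s ∈ Finset.range t, w s)) hκ
  have h6 := mul_le_mul_of_nonneg_left htN hε.le
  linarith

/-! ### Typical sample paths -/

section TypicalPath

variable {γ : ℝ} {v : ℝ≥0}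

/-- Along the path `ω` with cutoffs `c`, the average of `X₁`, the frequency of uncensored rounds and
the average over the uncensored rounds of `X₂ + γ X₁ - θ` are asymptotic to the averages of their
conditional expectations. -/
structure TypicalPath (γ : ℝ) (v : ℝ≥0) (μt : ℝ × ℝ) (θ : ℝ) (c : ℕ → ℝ) (ω : SamplePath) :
    Prop where
  fst : Tendsto (fun t : ℕ => (t : ℝ)⁻¹ * ∑ s ∈ Finset.range t, (ω s).1) atTop (𝓝 μt.1)
  count : Tendsto (fun t : ℕ => (t : ℝ)⁻¹ * (uncensoredCount c ω t -
    ∑ s ∈ Finset.range t, (gaussianReal μt.1 v).real (Iic (c s)))) atTop (𝓝 0)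
  sum : Tendsto (fun t : ℕ => (t : ℝ)⁻¹ * (uncensoredSum γ c ω t - θ * uncensoredCount c ω t -
    ∑ s ∈ Finset.range t, (gaussianReal μt.1 v).real (Iic (c s)) *
      (bestIntercept γ v μt (c s) - θ))) atTop (𝓝 0)

theorem setIntegral_censored_sub (hv : 0 < v) (μt : ℝ × ℝ) (θ c : ℝ) :
    ∫ x in {x : ℝ × ℝ | x.1 ≤ c}, (x.2 + γ * x.1 - θ)
      ∂((gaussianReal μt.1 v).prod (gaussianReal μt.2 v)) =
      (gaussianReal μt.1 v).real (Iic c) * (bestIntercept γ v μt c - θ) := by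
  have hset : {x : ℝ × ℝ | x.1 ≤ c} = Iic c ×ˢ univ := by ext x; simp
  have i1 : Integrable (fun x : ℝ × ℝ => x.2 + γ * x.1 - θ)
      ((gaussianReal μt.1 v).prod (gaussianReal μt.2 v)) :=
    (((integrable_id_gaussianReal μt.2 v).comp_snd _).add
      (((integrable_id_gaussianReal μt.1 v).comp_fst _).const_mul γ)).sub (integrable_const θ)
  rw [hset, setIntegral_prod _ i1.integrableOn, Measure.restrict_univ]
  have hinner : ∀ x : ℝ, ∫ y, (y + γ * x - θ) ∂gaussianReal μt.2 v =
      γ * (x - truncMean μt.1 v c) + (bestIntercept γ v μt c - θ) := fun x => by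
    have := integral_affine_gaussianReal (v := v) μt.2 1 (γ * x - θ)
    simp only [one_mul, ← add_sub_assoc] at this
    rw [this, bestIntercept]
    ring
  simp only [hinner]
  have i2 : Integrable (fun x => γ * (x - truncMean μt.1 v c)) (gaussianReal μt.1 v) :=
    ((integrable_id_gaussianReal _ v).sub (integrable_const _)).const_mul γ
  rw [integral_add i2.integrableOn (integrable_const _), integral_const_mul,
    setIntegral_sub_eq hv, sub_self]
  simp

theorem ae_typicalPath (hv : 0 < v) (μt : ℝ × ℝ) (θ : ℝ) {C : ℕ → SamplePath → ℝ}
    (hC : ∀ t, Measurable[drawsBefore t] (C t)) :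
    ∀ᵐ ω ∂trueLaw v μt, TypicalPath γ v μt θ (fun s => C s ω) ω := by
  set Q := (gaussianReal μt.1 v).prod (gaussianReal μt.2 v)
  have l1 : MemLp (fun x : ℝ × ℝ => x.1) 2 Q :=
    (memLp_id_gaussianReal (μ := μt.1) (v := v) 2).comp_fst _
  have l2 : MemLp (fun x : ℝ × ℝ => x.2) 2 Q :=
    (memLp_id_gaussianReal (μ := μt.2) (v := v) 2).comp_snd _
  have hf2 : MemLp (fun x : ℝ × ℝ => x.2 + γ * x.1 - θ) 2 Q :=
    (l2.add (l1.const_mul γ)).sub (memLp_const θ)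
  have h1 := ae_tendsto_average_zero (Q := Q) (F := fun _ x => x.1 - μt.1)
    (B := fun x => |x.1 - μt.1|) (by unfold Function.uncurry; fun_prop) (fun _ => by
      rw [integral_sub (l1.integrable one_le_two) (integrable_const _)]
      simp [Q, integral_fun_fst (fun x : ℝ => x), integral_id_gaussianReal])
    hC (l1.sub (memLp_const _)).abs (fun _ _ => le_rfl)
  have h2 := ae_tendsto_censored_average (Q := Q) (f := 1) measurable_one (memLp_const 1) hC
  have h3 := ae_tendsto_censored_average (Q := Q) (f := fun x : ℝ × ℝ => x.2 + γ * x.1 - θ)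
    (by fun_prop) hf2 hC
  filter_upwards [h1, h2, h3] with ω hω1 hω2 hω3
  refine ⟨?_, ?_, ?_⟩
  · have := hω1.add_const μt.1
    rw [zero_add] at this
    refine this.congr' ?_
    filter_upwards [eventually_gt_atTop 0] with t ht
    have : (t : ℝ) ≠ 0 := by exact_mod_cast ht.ne'
    rw [Finset.sum_sub_distrib]
    simp only [Finset.sum_const, Finset.card_range, nsmul_eq_mul]
    field_simp
    ring
  · refine hω2.congr fun t => ?_
    have hset : ∀ c : ℝ, {x : ℝ × ℝ | x.1 ≤ c} = Iic c ×ˢ univ := fun c => by ext x; simp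
    have e : ∀ c : ℝ, ∫ x in {x : ℝ × ℝ | x.1 ≤ c}, (1 : ℝ × ℝ → ℝ) x ∂Q =
        (gaussianReal μt.1 v).real (Iic c) := fun c => by simp [hset, Q]
    simp only [e]
    rw [Finset.sum_sub_distrib, uncensoredCount]
  · refine hω3.congr fun t => ?_
    simp only [Q, setIntegral_censored_sub hv μt θ]
    have e : ∀ s, {x : ℝ × ℝ | x.1 ≤ C s ω}.indicator (fun x => x.2 + γ * x.1 - θ) (ω s) =
        {x : ℝ × ℝ | x.1 ≤ C s ω}.indicator (fun x => x.2 + γ * x.1) (ω s) -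
          θ * {x : ℝ × ℝ | x.1 ≤ C s ω}.indicator 1 (ω s) := fun s => by
      simp only [indicator]
      split_ifs <;> simp
    simp only [e, uncensoredSum, uncensoredCount, Finset.mul_sum, Finset.sum_sub_distrib]

theorem TypicalPath.exists_count_lower_bound {μt : ℝ × ℝ} {θ : ℝ} {c : ℕ → ℝ} {ω : SamplePath}
    (hω : TypicalPath γ v μt θ c ω) (hv : 0 < v) {c₀ : ℝ} (hc : ∀ s, c₀ ≤ c s) :
    ∃ φ : ℝ, 0 < φ ∧ ∀ᶠ t : ℕ in atTop, φ * t ≤ uncensoredCount c ω t := by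
  have hΦ := gaussianReal_Iic_pos hv μt.1 c₀
  set Φ := (gaussianReal μt.1 v).real (Iic c₀)
  refine ⟨Φ / 2, by positivity, ?_⟩
  filter_upwards [hω.count.eventually_const_lt (show -(Φ / 2) < 0 by linarith),
    eventually_gt_atTop 0] with t ht ht0
  have ht' : (0 : ℝ) < t := by exact_mod_cast ht0
  have hsum : t * Φ ≤ ∑ s ∈ Finset.range t, (gaussianReal μt.1 v).real (Iic (c s)) := by
    have := Finset.card_nsmul_le_sum (Finset.range t)
      (fun s => (gaussianReal μt.1 v).real (Iic (c s))) Φ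
      fun s _ => measureReal_mono (Iic_subset_Iic.2 (hc s))
    simpa using this
  rw [inv_mul_eq_div, lt_div_iff₀ ht'] at ht
  linarith

/-- If the cutoffs are eventually within `L` of `cinf`, the peak of the likelihood in the intercept
is eventually within about `γ L` of the best intercept for `cinf`. -/
theorem TypicalPath.eventually_abs_peak_sub_le {μt : ℝ × ℝ} {θ : ℝ} {c : ℕ → ℝ} {ω : SamplePath}
    (hω : TypicalPath γ v μt θ c ω) (hγ : 0 < γ) (hv : 0 < v) {c₀ : ℝ} (hc : ∀ s, c₀ ≤ c s)
    {cinf L : ℝ} (hθ : θ = bestIntercept γ v μt cinf) (hL0 : 0 ≤ L)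
    (hL : ∀ᶠ s in atTop, |c s - cinf| ≤ L) {ε : ℝ} (hε : 0 < ε) :
    ∀ᶠ t in atTop, |uncensoredSum γ c ω t / uncensoredCount c ω t - θ| ≤ γ * L + ε := by
  obtain ⟨φ, hφ, hN⟩ := hω.exists_count_lower_bound hv hc
  refine eventually_abs_ratio_sub_le (by positivity) hφ (fun s => measureReal_nonneg) hω.count
    hω.sum ?_ hN hε
  filter_upwards [hL] with s hs
  rw [abs_mul, abs_of_nonneg measureReal_nonneg, mul_comm, hθ]
  refine mul_le_mul_of_nonneg_right ?_ measureReal_nonneg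
  exact (abs_bestIntercept_sub_le hγ hv _ _ _).trans (mul_le_mul_of_nonneg_left hs hγ.le)

end TypicalPath

/-! ### Convergence of beliefs and cutoffs along a typical path -/

section Convergence

variable {u₁ : ℝ → ℝ} {u₂ : ℝ → ℝ → ℝ} {γ : ℝ} {v : ℝ≥0} {a b α β : ℝ} {g : ℝ × ℝ → ℝ}

theorem isProbabilityMeasure_belief (hv : 0 < v) (hab : a < b) (hαβ : α < β)
    (hg : IsPriorDensity (sheared γ (Icc a b) (Icc α β)) g) (C : ℕ → SamplePath → ℝ) (t : ℕ)
    (ω : SamplePath) :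
    IsProbabilityMeasure (belief γ v (sheared γ (Icc a b) (Icc α β)) g C t ω) := by
  obtain ⟨k, hk, hL⟩ := exists_prod_likelihood_eq (γ := γ) hv (fun s => C s ω) ω t
  exact isProbabilityMeasure_posterior hab hαβ hg
    (f₁ := fun x => k * Real.exp (-(t * x ^ 2 - 2 * x * ∑ s ∈ Finset.range t, (ω s).1) / (2 * v)))
    (f₂ := fun θ => Real.exp (-(uncensoredCount (fun s => C s ω) ω t * θ ^ 2 -
      2 * θ * uncensoredSum γ (fun s => C s ω) ω t) / (2 * v)))
    (by fun_prop) (by fun_prop) (fun _ => by positivity) (fun _ => by positivity) hL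

variable {C : ℕ → SamplePath → ℝ} {ω : SamplePath} {μt : ℝ × ℝ} {θ : ℝ}

theorem TypicalPath.eventually_belief_fst_le
    (hω : TypicalPath γ v μt θ (fun s => C s ω) ω) (hv : 0 < v) (hab : a < b) (hαβ : α < β)
    (hg : IsPriorDensity (sheared γ (Icc a b) (Icc α β)) g) {c₀ : ℝ} (hc : ∀ s, c₀ ≤ C s ω)
    (hμ : μt.1 ∈ Icc a b) {ε δ : ℝ} (hε : 0 < ε) (hδ : 0 < δ) :
    ∀ᶠ t in atTop, (belief γ v (sheared γ (Icc a b) (Icc α β)) g C t ω).real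
      {μ | ε ≤ |μ.1 - μt.1|} ≤ δ := by
  have hv' : (0 : ℝ) < v := hv
  obtain ⟨φ, hφ, hN⟩ := hω.exists_count_lower_bound hv hc
  obtain ⟨r₀, hr₀⟩ := exists_posterior_concentration (v := v) hab hαβ hg (|μt.1| + 1)
    (half_pos hε) hδ
  have hlim : Tendsto (fun t : ℕ => (t : ℝ) / (2 * v)) atTop atTop :=
    tendsto_natCast_atTop_atTop.atTop_div_const (by positivity)
  have hnear : ∀ᶠ t : ℕ in atTop, |(t : ℝ)⁻¹ * ∑ s ∈ Finset.range t, (ω s).1 - μt.1| <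
      min 1 (ε / 2) := by
    have := (tendsto_iff_dist_tendsto_zero.1 hω.fst).eventually_lt_const
      (show 0 < min 1 (ε / 2) by positivity)
    simpa only [Real.dist_eq] using this
  filter_upwards [hN, hnear, hlim.eventually_ge_atTop r₀, eventually_gt_atTop 0]
    with t htN hty htr ht0
  have ht' : (0 : ℝ) < t := by exact_mod_cast ht0
  have hN0 : 0 < uncensoredCount (fun s => C s ω) ω t := (mul_pos hφ ht').trans_le htN
  obtain ⟨k, hk, hL⟩ := exists_prod_likelihood_eq_sq (γ := γ) hv (fun s => C s ω) ω ht0 hN0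
  have := isProbabilityMeasure_belief hv hab hαβ hg C t ω
  set y := (t : ℝ)⁻¹ * ∑ s ∈ Finset.range t, (ω s).1
  have hy : |y| ≤ |μt.1| + 1 := by
    have h1 := abs_sub_abs_le_abs_sub y μt.1
    linarith [min_le_left 1 (ε / 2)]
  have hb := (hr₀ _ t k _ y _ _ hk hL).1 htr hy
  refine ENNReal.toReal_le_of_le_ofReal hδ.le ((measure_mono fun μ hμS => ?_).trans hb)
  have h1 := abs_clamp_sub_le hμ y
  have h2 := abs_sub_le μ.1 (clamp a b y) μt.1
  have h3 : ε ≤ |μ.1 - μt.1| := hμS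
  change ε / 2 ≤ |μ.1 - clamp a b y|
  linarith [min_le_right 1 (ε / 2)]

theorem TypicalPath.eventually_belief_intercept_le
    (hω : TypicalPath γ v μt θ (fun s => C s ω) ω) (hv : 0 < v) (hab : a < b) (hαβ : α < β)
    (hg : IsPriorDensity (sheared γ (Icc a b) (Icc α β)) g) {c₀ : ℝ} (hc : ∀ s, c₀ ≤ C s ω)
    (hθ : θ ∈ Icc α β) {κ : ℝ}
    (hκ : ∀ᶠ t in atTop, |uncensoredSum γ (fun s => C s ω) ω t /
      uncensoredCount (fun s => C s ω) ω t - θ| ≤ κ) {ε δ : ℝ} (hε : 0 < ε) (hδ : 0 < δ) :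
    ∀ᶠ t in atTop, (belief γ v (sheared γ (Icc a b) (Icc α β)) g C t ω).real
      {μ | κ + ε ≤ |μ.2 + γ * μ.1 - θ|} ≤ δ := by
  have hv' : (0 : ℝ) < v := hv
  obtain ⟨φ, hφ, hN⟩ := hω.exists_count_lower_bound hv hc
  obtain ⟨r₀, hr₀⟩ := exists_posterior_concentration (v := v) hab hαβ hg (|θ| + κ) hε hδ
  have hlim : Tendsto (fun t : ℕ => φ * t / (2 * v)) atTop atTop :=
    (tendsto_natCast_atTop_atTop.const_mul_atTop hφ).atTop_div_const (by positivity)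
  filter_upwards [hN, hκ, hlim.eventually_ge_atTop r₀, eventually_gt_atTop 0]
    with t htN hty htr ht0
  have ht' : (0 : ℝ) < t := by exact_mod_cast ht0
  have hN0 : 0 < uncensoredCount (fun s => C s ω) ω t := (mul_pos hφ ht').trans_le htN
  obtain ⟨k, hk, hL⟩ := exists_prod_likelihood_eq_sq (γ := γ) hv (fun s => C s ω) ω ht0 hN0
  have := isProbabilityMeasure_belief hv hab hαβ hg C t ω
  set y := uncensoredSum γ (fun s => C s ω) ω t / uncensoredCount (fun s => C s ω) ω t
  have hy : |y| ≤ |θ| + κ := by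
    have h1 := abs_sub_abs_le_abs_sub y θ
    linarith
  have hr : r₀ ≤ uncensoredCount (fun s => C s ω) ω t / (2 * v) :=
    htr.trans (div_le_div_of_nonneg_right htN (by positivity))
  have hb := (hr₀ _ t k _ _ _ y hk hL).2 hr hy
  refine ENNReal.toReal_le_of_le_ofReal hδ.le ((measure_mono fun μ hμS => ?_).trans hb)
  have h1 := abs_clamp_sub_le hθ y
  have h2 := abs_sub_le (μ.2 + γ * μ.1) (clamp α β y) θ
  have h3 : κ + ε ≤ |μ.2 + γ * μ.1 - θ| := hμS
  change ε ≤ |μ.2 + γ * μ.1 - clamp α β y|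
  linarith

/-- Beliefs are supported on intercepts in `[α, β]`, so the cutoffs stay in a fixed compact
interval. -/
theorem RegularPayoffs.cutoff_mem_Icc (h : RegularPayoffs u₁ u₂) (hγ : 0 < γ) (hv : 0 < v)
    (hab : a < b) (hαβ : α < β)
    (hg : IsPriorDensity (sheared γ (Icc a b) (Icc α β)) g)
    (hC : IsCutoffProcess u₁ u₂ γ v (sheared γ (Icc a b) (Icc α β)) g C) (t : ℕ) (ω : SamplePath) :
    C t ω ∈ Icc (h.indifference hγ v α - 1) (h.indifference hγ v β + 1) := by
  have := isProbabilityMeasure_belief hv hab hαβ hg C t ω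
  have h0 : (belief γ v (sheared γ (Icc a b) (Icc α β)) g C t ω)
      (sheared γ (Icc a b) (Icc α β))ᶜ = 0 := posterior_compl_eq_zero _ _
  have hnull : ∀ S : Set (ℝ × ℝ), S ⊆ (sheared γ (Icc a b) (Icc α β))ᶜ →
      (belief γ v (sheared γ (Icc a b) (Icc α β)) g C t ω).real S = 0 := fun S hS => by
    rw [measureReal_def, measure_mono_null hS h0, ENNReal.toReal_zero]
  constructor
  · obtain ⟨δ, hδ, hle⟩ := h.exists_ge_of_isOptimalCutoff (β := β) hγ hv hab.le α one_pos
    refine hle _ h0 ?_ _ (hC.optimal t ω)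
    rw [hnull {μ | μ.2 + γ * μ.1 < α} fun μ hμ hμ' => (not_lt.2 hμ'.2.1) hμ]
    exact hδ.le
  · obtain ⟨δ, hδ, hle⟩ := h.exists_le_of_isOptimalCutoff (α := α) hγ hv hab.le β one_pos
    refine hle _ h0 ?_ _ (hC.optimal t ω)
    rw [hnull {μ | β < μ.2 + γ * μ.1} fun μ hμ hμ' => (not_lt.2 hμ'.2.2) hμ]
    exact hδ.le

/-- If the posterior over the intercept is eventually within `κ` of `θ`, the cutoffs are eventually
within about `l κ` of the cutoff that is optimal for `θ`. -/
theorem RegularPayoffs.eventually_abs_cutoff_sub_le (h : RegularPayoffs u₁ u₂) (hγ : 0 < γ)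
    (hv : 0 < v) (hab : a < b) (hαβ : α < β)
    (hg : IsPriorDensity (sheared γ (Icc a b) (Icc α β)) g)
    (hC : IsCutoffProcess u₁ u₂ γ v (sheared γ (Icc a b) (Icc α β)) g C) {l : ℝ} (hl0 : 0 < l)
    (hl : ∀ x₁ x₂ d : ℝ, 0 < d →
      u₂ (x₁ + l * d) (x₂ + (1 - γ * l) * d) - u₂ x₁ x₂ ≤ u₁ (x₁ + l * d) - u₁ x₁)
    {κ : ℝ} (hκ0 : 0 ≤ κ) (hκ : ∀ ε > 0, ∀ δ > 0, ∀ᶠ t in atTop,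
      (belief γ v (sheared γ (Icc a b) (Icc α β)) g C t ω).real
        {μ | κ + ε ≤ |μ.2 + γ * μ.1 - θ|} ≤ δ) {ε : ℝ} (hε : 0 < ε) :
    ∀ᶠ t in atTop, |C t ω - h.indifference hγ v θ| ≤ l * κ + ε := by
  set e := ε / (2 * l) with he
  have he0 : 0 < e := by positivity
  have hle : l * e = ε / 2 := by rw [he]; field_simp
  obtain ⟨δ₁, hδ₁, h₁⟩ := h.exists_le_of_isOptimalCutoff (α := α) (β := β) hγ hv hab.le
    (θ + (κ + e)) (half_pos hε)
  obtain ⟨δ₂, hδ₂, h₂⟩ := h.exists_ge_of_isOptimalCutoff (α := α) (β := β) hγ hv hab.le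
    (θ - (κ + e)) (half_pos hε)
  filter_upwards [hκ e he0 δ₁ hδ₁, hκ e he0 δ₂ hδ₂] with t ht₁ ht₂
  have := isProbabilityMeasure_belief hv hab hαβ hg C t ω
  have h0 : (belief γ v (sheared γ (Icc a b) (Icc α β)) g C t ω)
      (sheared γ (Icc a b) (Icc α β))ᶜ = 0 := posterior_compl_eq_zero _ _
  have s₁ : {μ : ℝ × ℝ | θ + (κ + e) < μ.2 + γ * μ.1} ⊆ {μ | κ + e ≤ |μ.2 + γ * μ.1 - θ|} := by
    intro μ hμ
    have hμ' : θ + (κ + e) < μ.2 + γ * μ.1 := hμ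
    exact (le_abs_self (μ.2 + γ * μ.1 - θ)).trans' (by linarith)
  have s₂ : {μ : ℝ × ℝ | μ.2 + γ * μ.1 < θ - (κ + e)} ⊆ {μ | κ + e ≤ |μ.2 + γ * μ.1 - θ|} := by
    intro μ hμ
    have hμ' : μ.2 + γ * μ.1 < θ - (κ + e) := hμ
    exact (neg_le_abs (μ.2 + γ * μ.1 - θ)).trans' (by linarith)
  have hup := h₁ _ h0 ((measureReal_mono s₁).trans ht₁) _ (hC.optimal t ω)
  have hlo := h₂ _ h0 ((measureReal_mono s₂).trans ht₂) _ (hC.optimal t ω)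
  have k₁ := (abs_le.1 (h.indifference_sub_le (v := v) hγ hl θ (θ + (κ + e)))).2
  have k₂ := (abs_le.1 (h.indifference_sub_le (v := v) hγ hl θ (θ - (κ + e)))).1
  rw [add_sub_cancel_left, abs_of_nonneg (by linarith)] at k₁
  rw [sub_sub_cancel_left, abs_neg, abs_of_nonneg (show 0 ≤ κ + e by linarith)] at k₂
  rw [abs_le]
  constructor <;> linarith

theorem RegularPayoffs.tendsto_cutoff (h : RegularPayoffs u₁ u₂)
    (hlip : LipschitzPayoffs u₁ u₂ γ) (hγ : 0 < γ) (hv : 0 < v) (hab : a < b) (hαβ : α < β)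
    (hg : IsPriorDensity (sheared γ (Icc a b) (Icc α β)) g)
    (hC : IsCutoffProcess u₁ u₂ γ v (sheared γ (Icc a b) (Icc α β)) g C)
    (hω : TypicalPath γ v μt θ (fun s => C s ω) ω) (hθ : θ ∈ Icc α β)
    (hfix : θ = bestIntercept γ v μt (h.indifference hγ v θ)) :
    Tendsto (fun t => C t ω) atTop (𝓝 (h.indifference hγ v θ)) := by
  obtain ⟨l, hl0, hl1, hl⟩ := hlip
  have hq : γ * l < 1 := by
    rw [lt_div_iff₀ hγ] at hl1
    linarith
  set cinf := h.indifference hγ v θ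
  have hmem := fun t => h.cutoff_mem_Icc hγ hv hab hαβ hg hC t ω
  rw [tendsto_iff_dist_tendsto_zero]
  simp only [Real.dist_eq]
  refine tendsto_zero_of_contraction (q := γ * l)
    (L₀ := |h.indifference hγ v α - 1 - cinf| + |h.indifference hγ v β + 1 - cinf|)
    (fun t => abs_nonneg _) (by positivity) hq (Eventually.of_forall fun t => ?_)
    fun L hL0 hL ε hε => ?_
  · exact abs_le_of_monotone (f := fun x => x - cinf) (fun x y hxy => sub_le_sub_right hxy _)
      (hmem t).1 (hmem t).2
  · set e := ε / (2 * l) with he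
    have he0 : 0 < e := by positivity
    have hle : l * e = ε / 2 := by rw [he]; field_simp
    have hpeak := hω.eventually_abs_peak_sub_le hγ hv (fun t => (hmem t).1) hfix hL0 hL he0
    have hb := fun ε' (hε' : 0 < ε') δ (hδ : 0 < δ) =>
      hω.eventually_belief_intercept_le hv hab hαβ hg (fun t => (hmem t).1) hθ hpeak hε' hδ
    have := h.eventually_abs_cutoff_sub_le hγ hv hab hαβ hg hC hl0 hl (by positivity) hb
      (half_pos hε)
    filter_upwards [this] with t ht
    refine ht.trans_eq ?_
    rw [mul_add, hle]
    ring

theorem RegularPayoffs.tendsto_belief (h : RegularPayoffs u₁ u₂)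
    (hlip : LipschitzPayoffs u₁ u₂ γ) (hγ : 0 < γ) (hv : 0 < v) (hab : a < b) (hαβ : α < β)
    (hg : IsPriorDensity (sheared γ (Icc a b) (Icc α β)) g)
    (hC : IsCutoffProcess u₁ u₂ γ v (sheared γ (Icc a b) (Icc α β)) g C)
    (hω : TypicalPath γ v μt θ (fun s => C s ω) ω) (hμ : μt.1 ∈ Icc a b) (hθ : θ ∈ Icc α β)
    (hfix : θ = bestIntercept γ v μt (h.indifference hγ v θ)) :
    Tendsto (fun t => ∫ μ, (|μ.1 - μt.1| + |μ.2 - (θ - γ * μt.1)|)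
      ∂(belief γ v (sheared γ (Icc a b) (Icc α β)) g C t ω)) atTop (𝓝 0) := by
  have hmem := fun t => h.cutoff_mem_Icc hγ hv hab hαβ hg hC t ω
  have hlim := h.tendsto_cutoff hlip hγ hv hab hαβ hg hC hω hθ hfix
  have hnear : ∀ L > 0, ∀ᶠ t in atTop, |C t ω - h.indifference hγ v θ| ≤ L := fun L hL => by
    have := (tendsto_iff_dist_tendsto_zero.1 hlim).eventually_le_const hL
    simpa only [Real.dist_eq] using this
  -- a bound on the integrand over the parallelogram
  set K := (1 + γ) * (b - a) + (β - α) with hK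
  have hK0 : 0 < K := by
    have := mul_pos (show 0 < 1 + γ by linarith) (sub_pos.2 hab)
    linarith
  refine tendsto_order.2 ⟨fun r hr => Eventually.of_forall fun t =>
    hr.trans_le (integral_nonneg fun μ => by positivity), fun r hr => ?_⟩
  set ε := r / (4 * (2 + γ)) with hε
  have hε0 : 0 < ε := by positivity
  have hεr : (2 + γ) * ε = r / 4 := by rw [hε]; field_simp
  set δ := r / (8 * K) with hδ
  have hδ0 : 0 < δ := by positivity
  have hδr : K * δ = r / 8 := by rw [hδ]; field_simp
  have hpeak := hω.eventually_abs_peak_sub_le hγ hv (fun t => (hmem t).1) hfix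
    (show 0 ≤ ε / (4 * γ) by positivity) (hnear _ (by positivity)) (show 0 < ε / 4 by positivity)
  have hpeak' : γ * (ε / (4 * γ)) + ε / 4 + ε / 2 = ε := by
    field_simp
    norm_num
  have hb2 := hω.eventually_belief_intercept_le hv hab hαβ hg (fun t => (hmem t).1) hθ hpeak
    (half_pos hε0) hδ0
  rw [hpeak'] at hb2
  filter_upwards [hω.eventually_belief_fst_le hv hab hαβ hg (fun t => (hmem t).1) hμ hε0 hδ0, hb2]
    with t ht₁ ht₂
  have := isProbabilityMeasure_belief hv hab hαβ hg C t ω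
  set ν := belief γ v (sheared γ (Icc a b) (Icc α β)) g C t ω
  have h0 : ν (sheared γ (Icc a b) (Icc α β))ᶜ = 0 := posterior_compl_eq_zero _ _
  set A₁ : Set (ℝ × ℝ) := {μ | ε ≤ |μ.1 - μt.1|}
  set A₂ : Set (ℝ × ℝ) := {μ | ε ≤ |μ.2 + γ * μ.1 - θ|}
  have hA₁ : MeasurableSet A₁ := measurableSet_le measurable_const (by fun_prop)
  have hA₂ : MeasurableSet A₂ := measurableSet_le measurable_const (by fun_prop)
  have i₁ : Integrable (A₁.indicator fun _ => K) ν := (integrable_const K).indicator hA₁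
  have i₂ : Integrable (A₂.indicator fun _ => K) ν := (integrable_const K).indicator hA₂
  have i₃ : Integrable (fun μ => (2 + γ) * ε + A₁.indicator (fun _ => K) μ) ν :=
    (integrable_const _).add i₁
  have hle : ∀ᵐ μ ∂ν, |μ.1 - μt.1| + |μ.2 - (θ - γ * μt.1)| ≤
      (2 + γ) * ε + A₁.indicator (fun _ => K) μ + A₂.indicator (fun _ => K) μ := by
    have : ∀ᵐ μ ∂ν, μ ∈ sheared γ (Icc a b) (Icc α β) := by
      rw [ae_iff]; exact h0
    filter_upwards [this] with μ hμM
    have h1 : |μ.1 - μt.1| ≤ b - a := abs_le.2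
      ⟨by linarith [hμM.1.1, hμ.2], by linarith [hμM.1.2, hμ.1]⟩
    have h2 : |μ.2 + γ * μ.1 - θ| ≤ β - α := abs_le.2
      ⟨by linarith [hμM.2.1, hθ.2], by linarith [hμM.2.2, hθ.1]⟩
    have h3 : |μ.2 - (θ - γ * μt.1)| ≤ |μ.2 + γ * μ.1 - θ| + γ * |μ.1 - μt.1| := by
      have e : μ.2 - (θ - γ * μt.1) = (μ.2 + γ * μ.1 - θ) - γ * (μ.1 - μt.1) := by ring
      rw [e]
      refine (abs_sub _ _).trans_eq ?_
      rw [abs_mul, abs_of_pos hγ]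
    have hbig : |μ.1 - μt.1| + |μ.2 - (θ - γ * μt.1)| ≤ K := by
      linarith [mul_le_mul_of_nonneg_left h1 hγ.le]
    have n₁ : 0 ≤ A₁.indicator (fun _ => K) μ := indicator_nonneg (fun _ _ => hK0.le) μ
    have n₂ : 0 ≤ A₂.indicator (fun _ => K) μ := indicator_nonneg (fun _ _ => hK0.le) μ
    have nε : 0 ≤ (2 + γ) * ε := by positivity
    by_cases m₁ : μ ∈ A₁
    · rw [indicator_of_mem m₁]
      linarith
    · by_cases m₂ : μ ∈ A₂
      · rw [indicator_of_mem m₂]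
        linarith
      · have l₁ : |μ.1 - μt.1| < ε := not_le.1 m₁
        have l₂ : |μ.2 + γ * μ.1 - θ| < ε := not_le.1 m₂
        linarith [mul_le_mul_of_nonneg_left l₁.le hγ.le]
  have hint : ∫ μ, (|μ.1 - μt.1| + |μ.2 - (θ - γ * μt.1)|) ∂ν ≤
      (2 + γ) * ε + ν.real A₁ * K + ν.real A₂ * K := by
    refine (integral_mono_of_nonneg (Eventually.of_forall fun μ => by positivity) (i₃.add i₂)
      hle).trans_eq ?_
    simp only [Pi.add_apply]
    rw [integral_add i₃ i₂, integral_add (integrable_const _) i₁, integral_indicator_const _ hA₁,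
      integral_indicator_const _ hA₂]
    simp
  have j₁ := mul_le_mul_of_nonneg_left ht₁ hK0.le
  have j₂ := mul_le_mul_of_nonneg_left ht₂ hK0.le
  linarith

end Convergence

end GamblersFallacy

/-! ### Convergence to the steady state -/

theorem theorem1 (u₁ : ℝ → ℝ) (u₂ : ℝ → ℝ → ℝ) (γ : ℝ) (v : ℝ≥0) (μ₁ μ₂ : ℝ)
    (hγ : 0 < γ) (hv : 0 < v)
    (hreg : RegularPayoffs u₁ u₂) (hlip : LipschitzPayoffs u₁ u₂ γ) :
    ∃ μ₂inf cinf : ℝ,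
      -- the unique steady state
      IsSteadyState u₁ u₂ γ v (μ₁, μ₂) (μ₁, μ₂inf) cinf ∧
      (∀ (μ : ℝ × ℝ) (c : ℝ), IsSteadyState u₁ u₂ γ v (μ₁, μ₂) μ c →
        μ = (μ₁, μ₂inf) ∧ c = cinf) ∧
      -- convergence, for every parallelogram that contains it and every prior
      (∀ a₁ b₁ a₂ b₂ : ℝ, a₁ < b₁ → a₂ < b₂ →
        (μ₁, μ₂inf) ∈ parallelogram γ a₁ b₁ a₂ b₂ →
        ∀ g : ℝ × ℝ → ℝ, IsPriorDensity (parallelogram γ a₁ b₁ a₂ b₂) g →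
        ∀ C : ℕ → SamplePath → ℝ,
          IsCutoffProcess u₁ u₂ γ v (parallelogram γ a₁ b₁ a₂ b₂) g C →
          ∀ᵐ ω ∂(trueLaw v (μ₁, μ₂)),
            Tendsto (fun t => C t ω) atTop (𝓝 cinf) ∧
            Tendsto (fun t => ∫ μ, (|μ.1 - μ₁| + |μ.2 - μ₂inf|)
                ∂(belief γ v (parallelogram γ a₁ b₁ a₂ b₂) g C t ω)) atTop (𝓝 0)) ∧
      -- over-pessimism
      μ₂inf < μ₂ ∧
      -- early stopping, relative to the optimal cutoff under the true model (bias 0)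
      ∃ copt : EReal, IsModelCutoff u₁ u₂ 0 v (μ₁, μ₂) copt ∧ (cinf : EReal) < copt := by
  obtain ⟨cinf, hc, huniq⟩ := hreg.existsUnique_fixedPoint hlip hγ hv (μ₁, μ₂)
  set θ := bestIntercept γ v (μ₁, μ₂) cinf with hθ
  refine ⟨θ - γ * μ₁, cinf, (hreg.isSteadyState_iff hγ hv _ _ _).2 ⟨rfl, hc⟩, fun μ c hss => ?_,
    fun a₁ b₁ a₂ b₂ h₁ h₂ hmem g hg C hC => ?_, ?_,
    hreg.exists_isModelCutoff_gt (hreg.stopGain_zero_neg hγ hv _ hc)⟩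
  · obtain ⟨hμ, hc'⟩ := (hreg.isSteadyState_iff hγ hv _ _ _).1 hss
    obtain rfl := huniq c hc'
    exact ⟨hμ, rfl⟩
  · rw [parallelogram_eq_sheared] at hmem hg hC ⊢
    have hαβ : a₂ + γ * ((a₁ + b₁) / 2) < b₂ + γ * ((a₁ + b₁) / 2) := by linarith
    have hθmem : θ ∈ Icc (a₂ + γ * ((a₁ + b₁) / 2)) (b₂ + γ * ((a₁ + b₁) / 2)) := by
      have := hmem.2
      simpa using this
    have hfix : θ = bestIntercept γ v (μ₁, μ₂) (hreg.indifference hγ v θ) := by rw [← hc]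
    filter_upwards [ae_typicalPath (γ := γ) hv (μ₁, μ₂) θ hC.predictable] with ω hω
    have hcut := hreg.tendsto_cutoff (μt := (μ₁, μ₂)) (θ := θ) hlip hγ hv h₁ hαβ hg hC hω hθmem hfix
    have hbel := hreg.tendsto_belief (μt := (μ₁, μ₂)) (θ := θ) hlip hγ hv h₁ hαβ hg hC hω hmem.1
      hθmem hfix
    rw [← hc] at hcut
    exact ⟨hcut, hbel⟩
  · have := mul_lt_mul_of_pos_left (truncMean_lt_mean hv μ₁ cinf) hγ
    rw [hθ, bestIntercept]
    linarith
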